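/- A $k$-CNF formula is a finite conjunction of clauses, each of which is a disjunction of exactly $k$ distinct literals. A $(k,s)$-CNF formula is a $k$-CNF formula in which every variable occurs (negated or not) in at most $s$ clauses. A CNF formula is in $\mathrm{MU}(1)$ if it is unsatisfiable, becomes satisfiable when any one of its clauses is deleted, and has exactly one more clause than it has variables. For $k\ge 1$ let $f(k)$ be the largest integer $s$ such that every $(k,s)$-CNF formula is satisfiable, and let $f_1(k)$ be the largest integer $s$ such that no $(k,s)$-CNF formula is in $\mathrm{MU}(1)$. Theorem. Both maxima exist for every $k\ge 1$. For all $k\ge 1$, $$\left\lfloor\frac{2^{k+1}}{ek}\right\rfloor-1\le f(k),$$ and $$f(k)=\left(e^{-1}+O(k^{-1/2})\right)\frac{2^{k+1}}{k}.$$ Moreover, the upper bound is attained within $\mathrm{MU}(1)$: there is an absolute constant $C$ such that for every $k\ge 1$ some $(k,s)$-CNF formula with $s\le\left(e^{-1}+Ck^{-1/2}\right)\frac{2^{k+1}}{k}$ is in $\mathrm{MU}(1)$. In particular, $f(k)=(1+o(1))f_1(k)$ as $k\to\infty$. -/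

import Mathlib

namespace KSat

/-- A literal `(v, b)` over the variables `v : ℕ`: the variable `v` itself if `b = true`,
its negation if `b = false`. -/
abbrev Literal := ℕ × Bool

/-- A clause: the disjunction of a finite set of (distinct) literals. -/
abbrev Clause := Finset Literal

/-- A CNF formula: the conjunction of a finite set of clauses. -/
abbrev CNF := Finset Clause

/-- The variables that occur, negated or not, in a clause. -/
def Clause.vars (C : Clause) : Finset ℕ := C.image Prod.fst

/-- The variables that occur in a formula. -/
def CNF.vars (F : CNF) : Finset ℕ := F.biUnion Clause.vars

/-- A clause is satisfied by a truth assignment if one of its literals is true. -/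
def Clause.SatisfiedBy (C : Clause) (a : ℕ → Bool) : Prop := ∃ l ∈ C, a l.1 = l.2

/-- A formula is satisfiable if some truth assignment satisfies all its clauses. -/
def CNF.Satisfiable (F : CNF) : Prop := ∃ a : ℕ → Bool, ∀ C ∈ F, Clause.SatisfiedBy C a

/-- The number of clauses of `F` in which the variable `v` occurs, negated or not. -/
def CNF.occurrences (F : CNF) (v : ℕ) : ℕ := (F.filter (fun C => v ∈ Clause.vars C)).card

/-- A `k`-CNF formula: every clause has exactly `k` distinct literals. -/
def CNF.IsKCNF (k : ℕ) (F : CNF) : Prop := ∀ C ∈ F, C.card = k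

/-- A `(k, s)`-CNF formula: a `k`-CNF formula in which every variable occurs in at most
`s` clauses. -/
def CNF.IsKSCNF (k s : ℕ) (F : CNF) : Prop :=
  CNF.IsKCNF k F ∧ ∀ v : ℕ, CNF.occurrences F v ≤ s

/-- Minimal unsatisfiable formulas: unsatisfiable, but satisfiable after the deletion of any
one clause. -/
def CNF.IsMU (F : CNF) : Prop :=
  ¬ CNF.Satisfiable F ∧ ∀ C ∈ F, CNF.Satisfiable (F.erase C)

/-- The class MU(1): minimal unsatisfiable formulas with exactly one more clause than
variables. -/
def CNF.IsMU1 (F : CNF) : Prop := CNF.IsMU F ∧ F.card = (CNF.vars F).card + 1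

/-- The `s` for which every `(k, s)`-CNF formula is satisfiable. -/
def satSet (k : ℕ) : Set ℕ := {s | ∀ F : CNF, CNF.IsKSCNF k s F → CNF.Satisfiable F}

/-- The `s` for which no `(k, s)`-CNF formula is in MU(1). -/
def noMU1Set (k : ℕ) : Set ℕ := {s | ∀ F : CNF, CNF.IsKSCNF k s F → ¬ CNF.IsMU1 F}

/-- `f k` is the largest `s` such that every `(k, s)`-CNF formula is satisfiable. -/
noncomputable def f (k : ℕ) : ℕ := sSup (satSet k)

/-- `f₁ k` is the largest `s` such that no `(k, s)`-CNF formula is in MU(1). -/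
noncomputable def f₁ (k : ℕ) : ℕ := sSup (noMU1Set k)

end KSat

/-! Lower bound: in the lopsided local lemma a clause depends only on the clauses that conflict with
it. Each variable is chosen at random with a slight bias towards literals whose negations are
frequent. A clause with many conflicts is then less likely to be false, by just the factor that its
conflicts cost, and `(s + 1) * e * k ≤ 2 ^ (k + 1)` suffices (`satisfiable_of_occurrences_le`).

Upper bound: a full binary tree gives a formula whose variables are the inner nodes, whose literals
are the edges, and whose clauses are the last `k` edges above each leaf (`treeFormula`). Walking
against an assignment reaches a falsified clause, and leaves outnumber inner nodes by one, so
suitable trees give MU(1) formulas (`treeFormula_spec`). What is needed is a tree without leaves at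
depth below `k` in which every inner node sees at most `d ≈ 2 ^ (k + 1) / (e k)` leaves; this is
`Good k d 0`.

The levels are grouped into blocks of length `L` of order `√k`, and block `q`, counted upwards from
level `k`, carries Kraft weight proportional to `D φ_q` per level. Moving down `L` levels shifts the
blocks by one and refills block 0. The leaves of the last block `Q` are all given to a fraction `x`
of the nodes, so the other nodes may take a share of the remaining leaves enlarged by the factor `1
+ x` (`Good.of_step`). With `φ_q = (1 + x) ^ q` this requires `x * 2 ^ (k + 1) ≤ L * D * (1 + x) ^
Q`. Since `L * Q ≈ k` and `x / (1 + x) ^ Q` never exceeds about `1 / (e Q)`, a `D` slightly above `2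
^ (k + 1) / (e k)` lets the growth rate rise without obstruction (`StepParams.good_zero`), until the
profile has room for an explicit tree (`good_zero_of_le`). -/

namespace KSat

open Finset

/-! ### Full binary trees, leaf addresses and visibility. -/

/-- Full binary trees; the children of an inner node are indexed by `Bool`. -/
inductive BTree where
  | leaf : BTree
  | node : (Bool → BTree) → BTree

namespace BTree

/-- The number of leaves at depth `i`. -/
def cnt : BTree → ℕ → ℕ
  | leaf, 0 => 1
  | leaf, _ + 1 => 0
  | node _, 0 => 0
  | node c, i + 1 => ∑ b, cnt (c b) i

/-- Every inner node sees at most `d` leaves within distance `k`, and each of its children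
has a leaf at distance less than `k`. -/
def Admissible (k d : ℕ) : BTree → Prop
  | leaf => True
  | node c => (∀ b, Admissible k d (c b) ∧ ∃ i < k, cnt (c b) i ≠ 0) ∧
      ∑ b, ∑ i ∈ range k, cnt (c b) i ≤ d

/-- The addresses of the leaves of a tree whose root has address `p`; the head of an address
is the direction of the last edge. -/
def leaves : BTree → List Bool → Finset (List Bool)
  | leaf, p => {p}
  | node c, p => univ.biUnion fun b => leaves (c b) (b :: p)

/-- The addresses of the inner nodes of a tree whose root has address `p`. -/
def inner : BTree → List Bool → Finset (List Bool)
  | leaf, _ => ∅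
  | node c, p => insert p (univ.biUnion fun b => inner (c b) (b :: p))

theorem suffix_of_mem_leaves {T : BTree} {p l : List Bool} (h : l ∈ T.leaves p) : p <:+ l := by
  induction T generalizing p with
  | leaf => simp only [leaves, mem_singleton] at h; subst h; exact List.suffix_refl _
  | node c ih =>
    simp only [leaves, mem_biUnion, mem_univ, true_and] at h
    obtain ⟨b, hb⟩ := h
    exact (List.suffix_cons b p).trans (ih b hb)

theorem suffix_of_mem_inner {T : BTree} {p q : List Bool} (h : q ∈ T.inner p) : p <:+ q := by
  induction T generalizing p with
  | leaf => simp [inner] at h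
  | node c ih =>
    simp only [inner, mem_insert, mem_biUnion, mem_univ, true_and] at h
    rcases h with rfl | ⟨b, hb⟩
    · exact List.suffix_refl _
    · exact (List.suffix_cons b p).trans (ih b hb)

theorem cons_suffix_unique {b b' : Bool} {p l : List Bool} (h : b :: p <:+ l)
    (h' : b' :: p <:+ l) : b = b' := by
  have := (List.suffix_of_suffix_length_le h h' (by simp)).eq_of_length (by simp)
  simpa using this

theorem not_cons_suffix_self {b : Bool} {p : List Bool} : ¬ b :: p <:+ p := fun h => by
  have := h.length_le
  simp at this

theorem card_leaves (T : BTree) (p : List Bool) : (T.leaves p).card = (T.inner p).card + 1 := by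
  induction T generalizing p with
  | leaf => simp [leaves, inner]
  | node c ih =>
    have h1 : p ∉ univ.biUnion fun b => inner (c b) (b :: p) := by
      simp only [mem_biUnion, mem_univ, true_and, not_exists]
      intro b hb
      exact not_cons_suffix_self (suffix_of_mem_inner hb)
    rw [leaves, inner, card_insert_of_notMem h1, card_biUnion, card_biUnion]
    · simp only [ih, Fintype.sum_bool]; ring
    · intro b _ b' _ hne
      rw [Function.onFun, Finset.disjoint_left]
      intro q hq hq'
      exact hne (cons_suffix_unique (suffix_of_mem_inner hq) (suffix_of_mem_inner hq'))
    · intro b _ b' _ hne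
      rw [Function.onFun, Finset.disjoint_left]
      intro q hq hq'
      exact hne (cons_suffix_unique (suffix_of_mem_leaves hq) (suffix_of_mem_leaves hq'))

theorem card_leaves_filter (T : BTree) (p : List Bool) (i : ℕ) :
    ((T.leaves p).filter (fun l => l.length = p.length + i)).card = T.cnt i := by
  induction T generalizing p i with
  | leaf =>
    cases i with
    | zero => simp [leaves, cnt, filter_singleton]
    | succ i => simp [leaves, cnt, filter_singleton]
  | node c ih =>
    rw [leaves, filter_biUnion, card_biUnion]
    · cases i with
      | zero =>
        simp only [cnt, sum_eq_zero_iff, card_eq_zero, filter_eq_empty_iff]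
        intro b _ l hl h
        have := (suffix_of_mem_leaves hl).length_le
        simp at this; omega
      | succ i =>
        rw [cnt]
        refine sum_congr rfl fun b _ => ?_
        rw [← ih b (b :: p) i]
        congr 2
        ext l
        simp only [List.length_cons]
        constructor <;> intro h <;> omega
    · intro b _ b' _ hne
      rw [Function.onFun, Finset.disjoint_left]
      intro q hq hq'
      exact hne (cons_suffix_unique (suffix_of_mem_leaves (mem_filter.1 hq).1)
        (suffix_of_mem_leaves (mem_filter.1 hq').1))

theorem card_leaves_filter_lt (T : BTree) (p : List Bool) (k : ℕ) :
    ((T.leaves p).filter (fun l => l.length < p.length + k)).card = ∑ i ∈ range k, T.cnt i := by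
  simp_rw [← card_leaves_filter T p]
  rw [← card_biUnion]
  · congr 1
    ext l
    simp only [mem_filter, mem_biUnion, mem_range]
    constructor
    · rintro ⟨h1, h2⟩
      have := (suffix_of_mem_leaves h1).length_le
      exact ⟨l.length - p.length, by omega, h1, by omega⟩
    · rintro ⟨i, hi, h1, h2⟩
      exact ⟨h1, by omega⟩
  · intro i _ j _ hne
    rw [Function.onFun, Finset.disjoint_left]
    intro q hq hq'
    exact hne (by have := (mem_filter.1 hq).2; have := (mem_filter.1 hq').2; omega)

/-- The edge in direction `b` below the inner node `q` is among the last `k` edges on the path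
to `l`. -/
def Sees (k : ℕ) (l q : List Bool) (b : Bool) : Prop := b :: q <:+ l ∧ l.length ≤ q.length + k

/-- Leaves that see `q` lie below `q`, so the induction descends to the subtree at `q`, where
`Admissible` gives the bound. Distance at most `k` from `q` is depth less than `k` in a child. -/
theorem card_sees_le {k d : ℕ} {T : BTree} (hT : T.Admissible k d) {p q : List Bool}
    (hpq : p <:+ q) (s : Finset (List Bool)) (hs : s ⊆ T.leaves p)
    (hs' : ∀ l ∈ s, ∃ b, Sees k l q b) : s.card ≤ d := by
  induction T generalizing p s with
  | leaf =>
    have : s = ∅ := by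
      refine eq_empty_of_forall_notMem fun l hl => ?_
      have h1 := hs hl
      simp only [leaves, mem_singleton] at h1
      subst h1
      obtain ⟨b, hb, -⟩ := hs' _ hl
      have h2 := hb.length_le
      have h3 := hpq.length_le
      simp at h2; omega
    simp [this]
  | node c ih =>
    rw [Admissible] at hT
    by_cases hq : q = p
    · subst hq
      refine le_trans ?_ hT.2
      simp_rw [← fun b => card_leaves_filter_lt (c b) (b :: q)]
      refine (card_le_card ?_).trans card_biUnion_le
      intro l hl
      have h1 := hs hl
      simp only [leaves, mem_biUnion, mem_univ, true_and] at h1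
      obtain ⟨b, hb⟩ := h1
      obtain ⟨b', hb', hlen⟩ := hs' l hl
      simp only [mem_biUnion, mem_univ, true_and, mem_filter]
      exact ⟨b, hb, by simp; omega⟩
    · obtain ⟨b, hb⟩ : ∃ b, b :: p <:+ q := by
        obtain ⟨t, rfl⟩ := hpq
        rcases List.eq_nil_or_concat t with rfl | ⟨t', b, rfl⟩
        · simp at hq
        · exact ⟨b, t', by simp⟩
      refine ih b (hT.1 b).1 hb s (fun l hl => ?_) hs'
      have h1 := hs hl
      simp only [leaves, mem_biUnion, mem_univ, true_and] at h1
      obtain ⟨b', hb'⟩ := h1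
      obtain ⟨b'', h2, -⟩ := hs' l hl
      have : b = b' := cons_suffix_unique (hb.trans ((List.suffix_cons _ _).trans h2))
        (suffix_of_mem_leaves hb')
      exact this ▸ hb'

theorem exists_sees_of_cnt_ne_zero {k : ℕ} {T : BTree} {p : List Bool} {b : Bool}
    (h : ∃ i < k, T.cnt i ≠ 0) : ∃ l ∈ T.leaves (b :: p), Sees k l p b := by
  obtain ⟨i, hi, h⟩ := h
  rw [← card_leaves_filter T (b :: p) i, card_ne_zero] at h
  obtain ⟨l, hl⟩ := h
  rw [mem_filter] at hl
  refine ⟨l, hl.1, suffix_of_mem_leaves hl.1, ?_⟩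
  have := hl.2
  simp at this; omega

theorem exists_sees_of_mem_inner {k d : ℕ} {T : BTree} (hT : T.Admissible k d) {p q : List Bool}
    (hq : q ∈ T.inner p) : ∃ l ∈ T.leaves p, ∃ b, Sees k l q b := by
  induction T generalizing p with
  | leaf => simp [inner] at hq
  | node c ih =>
    rw [Admissible] at hT
    simp only [inner, mem_insert, mem_biUnion, mem_univ, true_and] at hq
    simp only [leaves, mem_biUnion, mem_univ, true_and]
    rcases hq with rfl | ⟨b, hb⟩
    · obtain ⟨l, h1, h2⟩ := exists_sees_of_cnt_ne_zero (p := q) (b := true) (hT.1 true).2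
      exact ⟨l, ⟨_, h1⟩, _, h2⟩
    · obtain ⟨l, h1, h2⟩ := ih b (hT.1 b).1 hb
      exact ⟨l, ⟨_, h1⟩, h2⟩

theorem mem_inner_of_suffix {T : BTree} {p q l : List Bool} {b : Bool} (hl : l ∈ T.leaves p)
    (hpq : p <:+ q) (hq : b :: q <:+ l) : q ∈ T.inner p := by
  induction T generalizing p with
  | leaf =>
    simp only [leaves, mem_singleton] at hl
    subst hl
    exact absurd (hq.trans hpq) not_cons_suffix_self
  | node c ih =>
    simp only [leaves, mem_biUnion, mem_univ, true_and] at hl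
    obtain ⟨b', hb'⟩ := hl
    simp only [inner, mem_insert, mem_biUnion, mem_univ, true_and]
    by_cases h : q = p
    · exact Or.inl h
    · refine Or.inr ⟨b', ih b' hb' ?_⟩
      have h1 := suffix_of_mem_leaves hb'
      refine List.suffix_of_suffix_length_le h1 ((List.suffix_cons _ _).trans hq) ?_
      have h2 := hpq.length_le
      rcases h2.lt_or_eq with h3 | h3
      · simpa using h3
      · exact absurd (hpq.eq_of_length h3).symm h

/-- Every assignment falsifies all literals on the path to some leaf. -/
theorem exists_leaf_falsified (T : BTree) (p : List Bool) (a : List Bool → Bool) :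
    ∃ l ∈ T.leaves p, ∀ q b, p <:+ q → b :: q <:+ l → a q ≠ b := by
  induction T generalizing p with
  | leaf =>
    exact ⟨p, by simp [leaves], fun q b h h' => absurd (h'.trans h) not_cons_suffix_self⟩
  | node c ih =>
    -- Descend against the assignment, along the edge whose literal is false.
    obtain ⟨l, hl, h⟩ := ih (!a p) ((!a p) :: p)
    refine ⟨l, by simp only [leaves, mem_biUnion, mem_univ, true_and]; exact ⟨_, hl⟩, ?_⟩
    intro q b hpq hq
    by_cases hqp : q = p
    · subst hqp
      have := cons_suffix_unique (suffix_of_mem_leaves hl) hq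
      rw [← this]; simp
    · refine h q b ?_ hq
      refine List.suffix_of_suffix_length_le (suffix_of_mem_leaves hl)
        ((List.suffix_cons _ _).trans hq) ?_
      rcases hpq.length_le.lt_or_eq with h3 | h3
      · simpa using h3
      · exact absurd (hpq.eq_of_length h3).symm hqp

/-- For every leaf of an admissible tree some assignment satisfies the clauses of all other
leaves. -/
theorem exists_assignment_erase {k d : ℕ} {T : BTree} (hT : T.Admissible k d) {p l₀ : List Bool}
    (hl₀ : l₀ ∈ T.leaves p) : ∃ a : List Bool → Bool, ∀ l ∈ T.leaves p, l ≠ l₀ →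
      ∃ q b, p <:+ q ∧ Sees k l q b ∧ a q = b := by
  induction T generalizing p l₀ with
  | leaf =>
    simp only [leaves, mem_singleton] at hl₀
    subst hl₀
    exact ⟨fun _ => true, fun l hl hne => absurd (by simpa [leaves] using hl) hne⟩
  | node c ih =>
    rw [Admissible] at hT
    simp only [leaves, mem_biUnion, mem_univ, true_and] at hl₀
    obtain ⟨b₀, hb₀⟩ := hl₀
    obtain ⟨a₁, ha₁⟩ := ih b₀ (hT.1 b₀).1 hb₀
    -- Setting the root towards `!b₀` satisfies the clause of `l₂`, which sees the root, so `l₂` may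
    -- be the exception in its subtree. The two subtrees have disjoint variables, hence `a₁` and
    -- `a₂` can be glued.
    obtain ⟨l₂, hl₂, hs₂⟩ := exists_sees_of_cnt_ne_zero (p := p) (b := !b₀) (hT.1 (!b₀)).2
    obtain ⟨a₂, ha₂⟩ := ih (!b₀) (hT.1 (!b₀)).1 hl₂
    classical
    refine ⟨fun q => if q = p then !b₀ else if b₀ :: p <:+ q then a₁ q else a₂ q, ?_⟩
    intro l hl hne
    simp only [leaves, mem_biUnion, mem_univ, true_and] at hl
    obtain ⟨b, hb⟩ := hl
    by_cases hbb : b = b₀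
    · subst hbb
      obtain ⟨q, b', h1, h2, h3⟩ := ha₁ l hb hne
      refine ⟨q, b', (List.suffix_cons _ _).trans h1, h2, ?_⟩
      have hqp : q ≠ p := by rintro rfl; exact not_cons_suffix_self h1
      simp [hqp, h1, h3]
    · have hbb' : b = !b₀ := by cases b <;> cases b₀ <;> simp_all
      subst hbb'
      by_cases hl2 : l = l₂
      · subst hl2
        exact ⟨p, !b₀, List.suffix_refl _, hs₂, by simp⟩
      · obtain ⟨q, b', h1, h2, h3⟩ := ha₂ l hb hl2
        refine ⟨q, b', (List.suffix_cons _ _).trans h1, h2, ?_⟩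
        have hqp : q ≠ p := by rintro rfl; exact not_cons_suffix_self h1
        have h4 : ¬ b₀ :: p <:+ q := fun h => hbb (cons_suffix_unique h1 h)
        simp [hqp, h4, h3]

end BTree

/-! ### The MU(1) formula of an admissible tree. -/

open BTree

/-- The clause formed by the last `k` edges on the path with address `l`. -/
def pathClause : ℕ → List Bool → Clause
  | 0, _ => ∅
  | _ + 1, [] => ∅
  | k + 1, b :: l => insert (Encodable.encode l, b) (pathClause k l)

theorem mem_pathClause {k : ℕ} {l : List Bool} {x : Literal} :
    x ∈ pathClause k l ↔ ∃ q, x.1 = Encodable.encode q ∧ Sees k l q x.2 := by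
  induction k generalizing l with
  | zero =>
    simp only [pathClause, notMem_empty, false_iff, not_exists, not_and]
    rintro q - ⟨h1, h2⟩
    have := h1.length_le
    simp at this; omega
  | succ k ih =>
    cases l with
    | nil =>
      simp only [pathClause, notMem_empty, false_iff, not_exists, not_and]
      rintro q - ⟨h1, h2⟩
      simp at h1
    | cons b l =>
      simp only [pathClause, mem_insert, ih]
      constructor
      · rintro (h | ⟨q, h1, h2, h3⟩)
        · exact ⟨l, by rw [h], by rw [h]; exact ⟨List.suffix_refl _, by simp⟩⟩
        · exact ⟨q, h1, h2.trans (List.suffix_cons _ _), by simp; omega⟩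
      · rintro ⟨q, h1, h2, h3⟩
        rw [List.suffix_cons_iff] at h2
        rcases h2 with h2 | h2
        · simp only [List.cons.injEq] at h2
          left
          ext
          · rw [h1, h2.2]
          · simp [h2.1]
        · exact Or.inr ⟨q, h1, h2, by simp at h3; omega⟩

theorem card_pathClause {k : ℕ} {l : List Bool} (h : k ≤ l.length) : (pathClause k l).card = k := by
  induction k generalizing l with
  | zero => simp [pathClause]
  | succ k ih =>
    cases l with
    | nil => simp at h
    | cons b l =>
      rw [pathClause, card_insert_of_notMem, ih (by simpa using h)]
      rw [mem_pathClause]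
      rintro ⟨q, h1, h2, -⟩
      have := Encodable.encode_injective h1
      subst this
      exact not_cons_suffix_self h2

/-- The literal of the last edge encodes the whole address `l`; its presence in the clause of `l'`
makes `l` a suffix of `l'`, and the roles can be exchanged. -/
theorem pathClause_injOn {k : ℕ} (hk : 1 ≤ k) {l l' : List Bool} (hl : k ≤ l.length)
    (hl' : k ≤ l'.length) (h : pathClause k l = pathClause k l') : l = l' := by
  have key : ∀ {l l' : List Bool}, k ≤ l.length → pathClause k l = pathClause k l' → l <:+ l' := by
    intro l l' hl h
    cases l with
    | nil => simp
    | cons b l =>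
      have h1 : (Encodable.encode l, b) ∈ pathClause k (b :: l) :=
        mem_pathClause.2 ⟨l, rfl, List.suffix_refl _, by simp; omega⟩
      rw [h, mem_pathClause] at h1
      obtain ⟨q, h2, h3, -⟩ := h1
      have := Encodable.encode_injective h2
      subst this
      exact h3
  exact (key hl h).eq_of_length (le_antisymm (key hl h).length_le (key hl' h.symm).length_le)

/-- The formula of a tree: one clause for each leaf. -/
def treeFormula (k : ℕ) (T : BTree) : CNF := (T.leaves []).image (pathClause k)

theorem mem_vars_pathClause {k v : ℕ} {l : List Bool} :
    v ∈ Clause.vars (pathClause k l) ↔ ∃ q b, v = Encodable.encode q ∧ Sees k l q b := by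
  simp only [Clause.vars, mem_image, mem_pathClause, Prod.exists, exists_and_right,
    exists_eq_right]
  exact exists_comm

theorem treeFormula_spec {k d : ℕ} (hk : 1 ≤ k) {T : BTree} (hT : T.Admissible k d)
    (h0 : ∀ i < k, T.cnt i = 0) :
    CNF.IsKSCNF k d (treeFormula k T) ∧ CNF.IsMU1 (treeFormula k T) := by
  have hlen : ∀ l ∈ T.leaves [], k ≤ l.length := by
    intro l hl
    by_contra h
    push Not at h
    have h1 := h0 _ h
    rw [← card_leaves_filter T [] l.length, card_eq_zero] at h1
    have : l ∈ (∅ : Finset (List Bool)) := h1 ▸ mem_filter.2 ⟨hl, by simp⟩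
    simp at this
  have hinj : Set.InjOn (pathClause k) (T.leaves [] : Set (List Bool)) := fun l hl l' hl' h =>
    pathClause_injOn hk (hlen l hl) (hlen l' hl') h
  refine ⟨⟨?_, ?_⟩, ⟨?_, ?_⟩, ?_⟩
  · intro C hC
    obtain ⟨l, hl, rfl⟩ := mem_image.1 hC
    exact card_pathClause (hlen l hl)
  · intro v
    rw [CNF.occurrences, treeFormula, filter_image]
    refine card_image_le.trans ?_
    by_cases hv : ∃ q : List Bool, v = Encodable.encode q
    · obtain ⟨q, rfl⟩ := hv
      refine card_sees_le hT (q := q) List.nil_suffix _ (filter_subset _ _) ?_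
      intro l hl
      obtain ⟨q', b, h1, h2⟩ := mem_vars_pathClause.1 (mem_filter.1 hl).2
      rw [Encodable.encode_injective h1]
      exact ⟨b, h2⟩
    · rw [filter_eq_empty_iff.2, card_empty]
      · exact Nat.zero_le _
      · intro l _ h
        obtain ⟨q', b, h1, h2⟩ := mem_vars_pathClause.1 h
        exact hv ⟨q', h1⟩
  · rintro ⟨a, ha⟩
    obtain ⟨l, hl, h⟩ := exists_leaf_falsified T [] (fun q => a (Encodable.encode q))
    obtain ⟨x, hx, hx'⟩ := ha _ (mem_image_of_mem _ hl)
    obtain ⟨q, h1, h2⟩ := mem_pathClause.1 hx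
    refine h q x.2 List.nil_suffix h2.1 ?_
    rw [← h1, hx']
  · intro C hC
    obtain ⟨l₀, hl₀, rfl⟩ := mem_image.1 hC
    obtain ⟨a, ha⟩ := exists_assignment_erase hT hl₀
    refine ⟨fun v => (Encodable.decode v).elim true a, fun C hC => ?_⟩
    rw [mem_erase] at hC
    obtain ⟨l, hl, rfl⟩ := mem_image.1 hC.2
    obtain ⟨q, b, -, h2, h3⟩ := ha l hl (fun h => hC.1 (by rw [h]))
    exact ⟨(Encodable.encode q, b), mem_pathClause.2 ⟨q, rfl, h2⟩, by simpa using h3⟩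
  · have hv : CNF.vars (treeFormula k T) = (T.inner []).image Encodable.encode := by
      ext v
      simp only [CNF.vars, treeFormula, mem_biUnion, mem_image, exists_exists_and_eq_and,
        mem_vars_pathClause]
      constructor
      · rintro ⟨l, hl, q, b, rfl, h⟩
        exact ⟨q, mem_inner_of_suffix hl List.nil_suffix h.1, rfl⟩
      · rintro ⟨q, hq, rfl⟩
        obtain ⟨l, hl, b, h⟩ := exists_sees_of_mem_inner hT hq
        exact ⟨l, hl, q, b, rfl, h⟩
    rw [hv, card_image_of_injective _ Encodable.encode_injective, treeFormula,
      card_image_of_injOn hinj, card_leaves]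

/-! ### Leaf vectors realised by admissible trees. -/

/-- Some admissible tree has at most `x i` leaves at every depth `i < k`. -/
def Good (k d : ℕ) (x : ℕ → ℕ) : Prop := ∃ T : BTree, T.Admissible k d ∧ ∀ i < k, T.cnt i ≤ x i

theorem Good.mono {k d : ℕ} {x y : ℕ → ℕ} (h : Good k d x) (hxy : ∀ i < k, x i ≤ y i) :
    Good k d y := by
  obtain ⟨T, h1, h2⟩ := h
  exact ⟨T, h1, fun i hi => (h2 i hi).trans (hxy i hi)⟩

theorem good_leaf {k d : ℕ} {x : ℕ → ℕ} (h : 1 ≤ x 0) : Good k d x :=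
  ⟨leaf, trivial, fun i _ => by cases i <;> simp [cnt, h]⟩

theorem good_node {k d : ℕ} {x : ℕ → ℕ} {y : Bool → ℕ → ℕ} (hy : ∀ b, Good k d (y b))
    (hyx : ∀ i, i + 1 < k → ∑ b, y b i ≤ x (i + 1))
    (hd : ∑ b, ∑ i ∈ range k, y b i ≤ d) : Good k d x := by
  choose T h1 h2 using hy
  by_cases h : ∀ b, ∃ i < k, (T b).cnt i ≠ 0
  · refine ⟨node T, ?_, ?_⟩
    · rw [Admissible]
      exact ⟨fun b => ⟨h1 b, h b⟩, le_trans (sum_le_sum fun b _ => sum_le_sum fun i hi =>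
        h2 b i (mem_range.1 hi)) hd⟩
    · intro i hi
      cases i with
      | zero => simp [cnt]
      | succ i => exact le_trans (sum_le_sum fun b _ => h2 b i (by omega)) (hyx i hi)
  -- A child without leaves at depth below `k` realises every vector and can replace the whole node.
  -- This secures the nonemptiness condition in `Admissible`, on which minimality rests.
  · push Not at h
    obtain ⟨b, hb⟩ := h
    exact ⟨T b, h1 b, fun i hi => by rw [hb i hi]; exact Nat.zero_le _⟩

/-- Joins `2 ^ h` consecutive trees below a complete tree of height `h`. A node above `2 ^ (h' + 1)`
of them has children at height `h'`, from which depth below `k` reaches only the first `k - h'`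
levels of each tree. -/
theorem good_family {k d N : ℕ} {f : ℕ → ℕ → ℕ} (hf : ∀ p < N, Good k d (f p)) (h : ℕ)
    (hsum : ∀ h' < h, ∀ s, s + 2 ^ (h' + 1) ≤ N →
      ∑ p ∈ range (2 ^ (h' + 1)), ∑ i ∈ range (k - h'), f (s + p) i ≤ d)
    (s : ℕ) (hs : s + 2 ^ h ≤ N) :
    Good k d fun i => if i < h then 0 else ∑ p ∈ range (2 ^ h), f (s + p) (i - h) := by
  induction h generalizing s with
  | zero => simpa using hf s (by simpa using hs)
  | succ h ih =>
    have hpow : 2 ^ (h + 1) = 2 ^ h + 2 ^ h := by ring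
    have hpos : 0 < 2 ^ h := by positivity
    have ih' := ih fun h' hh => hsum h' (by omega)
    refine good_node (y := fun b i => if i < h then 0 else
      ∑ p ∈ range (2 ^ h), f ((bif b then s + 2 ^ h else s) + p) (i - h)) ?_ ?_ ?_
    · rintro (_ | _)
      · exact ih' s (by omega)
      · exact ih' (s + 2 ^ h) (by omega)
    · intro i _
      by_cases hi : i < h
      · simp [hi]
      · rw [if_neg (by omega), hpow, sum_range_add]
        simp only [hi, if_false, Fintype.sum_bool, cond_true, cond_false, Nat.add_sub_add_right,
          add_assoc]
        rw [add_comm]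
    · have key : ∀ s, ∑ i ∈ range k, (if i < h then 0 else
          ∑ p ∈ range (2 ^ h), f (s + p) (i - h)) =
          ∑ p ∈ range (2 ^ h), ∑ i ∈ range (k - h), f (s + p) i := by
        intro s
        rw [sum_comm]
        rcases le_total h k with hk | hk
        · obtain ⟨m, rfl⟩ := Nat.exists_eq_add_of_le hk
          rw [sum_range_add, sum_eq_zero fun i hi => if_pos (mem_range.1 hi)]
          simp
        · rw [Nat.sub_eq_zero_of_le hk, sum_eq_zero fun i hi =>
            if_pos ((mem_range.1 hi).trans_le hk)]
          simp
      have h1 := hsum h (by omega) s hs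
      rw [hpow, sum_range_add] at h1
      simp only [key, Fintype.sum_bool, cond_true, cond_false]
      rw [add_comm]
      simpa only [add_assoc] using h1

theorem good_complete {k d n : ℕ} (h : 2 ^ n ≤ d) :
    Good k d fun i => if i = n then 2 ^ n else 0 := by
  induction n with
  | zero => exact good_leaf (by simp)
  | succ n ih =>
    have hpow : 2 ^ (n + 1) = 2 ^ n + 2 ^ n := by ring
    refine good_node (fun _ => ih (by omega)) ?_ ?_
    · intro i _
      by_cases hi : i = n <;> simp [hi, hpow, two_mul]
    · simp only [sum_ite_eq', Fintype.sum_bool]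
      split_ifs <;> omega

/-- The leaf vector that puts Kraft weight `2 ^ (-μ)` on each of the `2 ^ μ` levels from `s`
on. -/
def uniformVec (μ s i : ℕ) : ℕ := if s ≤ i ∧ i < s + 2 ^ μ then 2 ^ (i - μ) else 0

/-- Complete trees of heights `s - μ + p`, `p < 2 ^ μ`, hang below a complete tree of height `μ`,
and the `p`-th fills level `s + p`. The leaf counts are geometric, so their sum is controlled by the
next power of two. -/
theorem good_uniformVec {k d μ s : ℕ} (hs : μ ≤ s) (hd : 2 ^ (s - μ + 2 ^ μ) ≤ d) :
    Good k d (uniformVec μ s) := by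
  have hle : ∀ p ≤ 2 ^ μ, 2 ^ (s - μ + p) ≤ d := fun p hp =>
    (Nat.pow_le_pow_right (by norm_num) (by omega)).trans hd
  have h1 := good_family (k := k) (d := d) (N := 2 ^ μ)
    (f := fun p i => if i = s - μ + p then 2 ^ (s - μ + p) else 0)
    (fun p hp => good_complete (hle p hp.le)) μ ?_ 0 (by simp)
  · refine h1.mono fun i _ => ?_
    rw [uniformVec]
    split_ifs with h2 h3 h3
    · exact Nat.zero_le _
    · exact Nat.zero_le _
    · rw [sum_eq_single (i - s)]
      · rw [if_pos (by omega)]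
        exact le_of_eq (congrArg _ (by omega))
      · intro p _ hp
        exact if_neg (by omega)
      · intro h
        exact absurd (mem_range.2 (by omega)) h
    · refine le_of_eq (sum_eq_zero fun p hp => if_neg ?_)
      have := mem_range.1 hp
      intro h
      omega
  · intro h' _ s' hs'
    refine le_trans ?_ (hle _ hs')
    calc _ ≤ ∑ p ∈ range (2 ^ (h' + 1)), 2 ^ (s - μ + s') * 2 ^ p := by
          refine sum_le_sum fun p _ => ?_
          rw [sum_ite_eq', ← pow_add, add_assoc]
          split_ifs <;> simp
      _ ≤ 2 ^ (s - μ + s') * 2 ^ (2 ^ (h' + 1)) := by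
          rw [← mul_sum]
          exact Nat.mul_le_mul_left _ (Nat.geomSum_lt (le_refl _) (by simp)).le
      _ = _ := by rw [← pow_add, add_assoc]

/-! ### Block profiles and the step between them. -/

/-- The leaf vector whose levels are divided into blocks of length `L`, counted from `k`
downwards, such that the levels of block `q` carry Kraft weight about `D φ_q / 2 ^ (k + 1)`. -/
noncomputable def profile (k L Q : ℕ) (D : ℝ) (φ : ℕ → ℝ) (i : ℕ) : ℕ :=
  if (k - i) / L ≤ Q then ⌊D * φ ((k - i) / L) / 2 ^ (k - i + 1)⌋₊ else 0

/-- An upper bound for a profile with growth `G` from the first block to the second and growth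
two afterwards. -/
noncomputable def capWeight (L : ℕ) (G : ℝ) (t : ℕ) : ℝ :=
  (if t / L = 0 then 1 else G * 2 ^ (t / L - 1)) / 2 ^ (t + 1)

theorem capWeight_nonneg {L : ℕ} {G : ℝ} (hG : 1 ≤ G) (t : ℕ) : 0 ≤ capWeight L G t := by
  unfold capWeight
  have : 0 ≤ G := by linarith
  split_ifs <;> positivity

/-- Up to the factor `D`, this bounds the leaves seen by a node at height `h` in the complete tree
of one step. A potential `P` drops by at least `capWeight` at each `t`, so the sum telescopes. Its
term `2 / 2 ^ ((t / L + 1) * L)` pays for the doubling at the next block boundary, which uses `4 ≤ 2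
^ L`. -/
theorem sum_capWeight_le {L : ℕ} {G : ℝ} (hL : 2 ≤ L) (hG : 1 ≤ G) {h : ℕ} (hh : h ≤ L) (n : ℕ)
    (hn : h ≤ n) : 2 ^ h * ∑ t ∈ Ico h n, capWeight L G t ≤ G * (1 + 2 / 2 ^ L) := by
  have h4 : (4 : ℝ) ≤ 2 ^ L := by
    calc (4 : ℝ) = 2 ^ 2 := by norm_num
      _ ≤ 2 ^ L := pow_le_pow_right₀ (by norm_num) hL
  set P : ℕ → ℝ := fun t => if t / L = 0 then G * (1 + 2 / 2 ^ L) / 2 ^ t else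
    G * 2 ^ (t / L - 1) * (1 / 2 ^ t + 2 / 2 ^ ((t / L + 1) * L)) with hP
  have hP0 : ∀ t, 0 ≤ P t := by
    intro t
    have : 0 ≤ G := by linarith
    simp only [hP]
    split_ifs <;> positivity
  have hstep : ∀ t, capWeight L G t ≤ P t - P (t + 1) := by
    intro t
    have hL0 : 0 < L := by omega
    have hsucc := Nat.succ_div (a := t) (b := L)
    have h2t : (0 : ℝ) < 2 ^ t := by positivity
    by_cases hdiv : L ∣ t + 1
    · rw [if_pos hdiv] at hsucc
      obtain ⟨r, hr⟩ := hdiv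
      have hr' : (t + 1) / L = r := by rw [hr]; exact Nat.mul_div_cancel_left _ hL0
      have hq : t / L + 1 = r := by omega
      simp only [hP, capWeight, hr']
      rw [if_neg (show r ≠ 0 by rintro rfl; simp at hr)]
      have e1 : (r + 1) * L = t + 1 + L := by rw [hr]; ring
      rw [e1]
      by_cases h0 : t / L = 0
      · have : r = 1 := by omega
        rw [if_pos h0, if_pos h0, this]
        have e2 : t + 1 = L := by rw [hr, this, mul_one]
        have e3 : (2 : ℝ) ^ L = 2 ^ (t + 1) := by rw [e2]
        rw [e3]
        have e4 : (2 : ℝ) ^ (t + 1 + L) = 2 ^ (t + 1) * 2 ^ (t + 1) := by rw [pow_add, e3]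
        rw [e4]
        have e5 : (2 : ℝ) ^ (t + 1) = 2 * 2 ^ t := by ring
        rw [e5]
        rw [← sub_nonneg]
        have : G * (1 + 2 / (2 * 2 ^ t)) / 2 ^ t - G * 2 ^ (1 - 1) * (1 / (2 * 2 ^ t) +
          2 / (2 * 2 ^ t * (2 * 2 ^ t))) - 1 / (2 * 2 ^ t) =
          (G - 1) / (2 * 2 ^ t) + G / (2 * 2 ^ t * 2 ^ t) := by
          field_simp; ring
        rw [this]
        have : 0 ≤ G - 1 := by linarith
        positivity
      · rw [if_neg h0, if_neg h0]
        obtain ⟨m, hm⟩ := Nat.exists_eq_succ_of_ne_zero h0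
        have e2 : r - 1 = m + 1 := by omega
        have e3 : t / L - 1 = m := by omega
        have e4 : (t / L + 1) * L = t + 1 := by rw [hq, hr, mul_comm]
        rw [e2, e3, e4, pow_add 2 (t + 1) L, ← sub_nonneg]
        have : G * 2 ^ m * (1 / 2 ^ t + 2 / 2 ^ (t + 1)) - G * 2 ^ (m + 1) *
          (1 / 2 ^ (t + 1) + 2 / (2 ^ (t + 1) * 2 ^ L)) - G * 2 ^ m / 2 ^ (t + 1) =
          G * 2 ^ m / 2 ^ (t + 1) / 2 ^ L * (2 ^ L - 4) := by
          field_simp; ring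
        rw [this]
        have : (0 : ℝ) ≤ 2 ^ L - 4 := by linarith
        have : 0 ≤ G := by linarith
        positivity
    · rw [if_neg hdiv, add_zero] at hsucc
      simp only [hP, capWeight, hsucc]
      by_cases h0 : t / L = 0
      · simp only [if_pos h0, pow_succ]
        rw [← sub_nonneg]
        have : G * (1 + 2 / 2 ^ L) / 2 ^ t - G * (1 + 2 / 2 ^ L) / (2 ^ t * 2) - 1 / (2 ^ t * 2) =
          (G * (1 + 2 / 2 ^ L) - 1) / (2 ^ t * 2) := by field_simp; ring
        rw [this]
        have : 1 ≤ G * (1 + 2 / 2 ^ L) := by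
          have : (0 : ℝ) ≤ 2 / 2 ^ L := by positivity
          nlinarith
        exact div_nonneg (by linarith) (by positivity)
      · simp only [if_neg h0]
        refine le_of_eq ?_
        rw [pow_succ]
        field_simp
        ring
  have hsum : ∀ n, h ≤ n → ∑ t ∈ Ico h n, capWeight L G t ≤ P h - P n := by
    intro n hn
    induction n, hn using Nat.le_induction with
    | base => simp
    | succ m hm ih =>
      rw [sum_Ico_succ_top hm]
      linarith [hstep m]
  have hPh : 2 ^ h * P h ≤ G * (1 + 2 / 2 ^ L) := by
    rcases hh.lt_or_eq with h1 | h1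
    · simp only [hP, Nat.div_eq_of_lt h1, if_true]
      refine le_of_eq ?_
      field_simp
    · subst h1
      have : h / h = 1 := Nat.div_self (by omega)
      simp only [hP, this]
      refine le_of_eq ?_
      norm_num
      rw [mul_comm 2 h, pow_mul]
      field_simp
  calc _ ≤ 2 ^ h * P h := by
        have := hsum n hn
        have := hP0 n
        gcongr
        linarith
    _ ≤ _ := hPh

/-- One step of the construction: below a node with profile `φ`, all nodes at distance `L` but
`a` of them get the profile `φ'`, and the remaining `a` share the last block of leaves. -/
theorem Good.of_step {k d L μ Q a : ℕ} {D g G : ℝ} {φ φ' : ℕ → ℝ} (hL : L = 2 ^ μ) (hL2 : 2 ≤ L)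
    (hQ : (Q + 3) * L ≤ k) (hD : 0 < D) (hG1 : 1 ≤ G) (hG2 : G ≤ 2)
    (hg : 0 ≤ g) (ha : a ≤ 2 ^ L) (hag : ((2 : ℝ) ^ L - a) * g ≤ 2 ^ L) (hφ : ∀ q, 0 ≤ φ q)
    (h0 : φ' 0 = 1) (hsucc : ∀ q, φ' (q + 1) = g * φ q) (hφ' : ∀ q ≤ Q, φ' q ≤ G ^ q)
    (hcond : a * 2 ^ (k + 1) ≤ L * D * 2 ^ L * φ Q) (hDQ : (2 : ℝ) ^ (k + 1) ≤ L * D * 2 ^ Q)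
    (hd : D * (G * (1 + 2 / 2 ^ L)) ≤ d) (h : Good k d (profile k L Q D φ')) :
    Good k d (profile k L Q D φ) := by
  have hL0 : 0 < L := by omega
  have hμL : μ < L := hL ▸ Nat.lt_two_pow_self
  have hQL : (Q + 3) * L = Q * L + L + L + L := by ring
  have hQQ : Q ≤ Q * L := Nat.le_mul_of_pos_right _ hL0
  -- The `L = 2 ^ μ` levels from `s` on are block `Q + 1` seen from the bottom of the step, hence
  -- block `Q` seen from its top.
  set s := k - (Q + 2) * L + 1 with hsdef
  have hs2 : (Q + 2) * L = Q * L + L + L := by ring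
  have hdD : D ≤ d := by
    refine le_trans ?_ hd
    have h1 : (0 : ℝ) ≤ 2 / 2 ^ L := by positivity
    have h2 : 1 ≤ G * (1 + 2 / 2 ^ L) := by nlinarith
    nlinarith
  have hLR : (L : ℝ) = 2 ^ μ := by rw [hL]; push_cast; rfl
  -- the block of a level in the window
  have hwin : ∀ i ≤ k, (s ≤ i ∧ i < s + 2 ^ μ) ↔ (k - i) / L = Q + 1 := by
    intro i hi
    rw [Nat.div_eq_iff hL0, ← hL]
    have e1 : (Q + 1) * L = Q * L + L := by ring
    omega
  have hT : Good k d (uniformVec μ s) := by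
    refine good_uniformVec (by omega) ?_
    have h1 : (2 : ℝ) ^ (s - μ + 2 ^ μ) ≤ D := by
      have h2 : (2 : ℝ) ^ (s - μ + 2 ^ μ) * (L * 2 ^ Q) ≤ 2 ^ (k + 1) := by
        rw [hLR, ← pow_add, ← pow_add]
        refine pow_le_pow_right₀ (by norm_num) ?_
        rw [← hL]
        omega
      have h3 : (0 : ℝ) < L * 2 ^ Q := by rw [hLR]; positivity
      nlinarith
    exact_mod_cast h1.trans hdD
  have hcapT : ∀ i < k, (uniformVec μ s i : ℝ) ≤ D * capWeight L G (k - i) := by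
    intro i hi
    unfold uniformVec
    split_ifs with h1
    · have h2 := (hwin i hi.le).1 h1
      rw [capWeight, h2, if_neg (by omega), Nat.add_sub_cancel]
      rw [mul_div_assoc', le_div_iff₀ (by positivity)]
      have h3 : (2 : ℝ) ^ (i - μ) * 2 ^ (k - i + 1) * L = 2 ^ (k + 1) := by
        rw [hLR, ← pow_add, ← pow_add]
        congr 1
        omega
      have h4 : (0 : ℝ) < L := by exact_mod_cast hL0
      push_cast
      have h5 : (L : ℝ) * D * 2 ^ Q ≤ L * D * 2 ^ Q * G := le_mul_of_one_le_right (by positivity) hG1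
      nlinarith
    · have := capWeight_nonneg (L := L) hG1 (k - i)
      simp only [Nat.cast_zero]
      positivity
  have hcapB : ∀ i < k, (profile k L Q D φ' i : ℝ) ≤ D * capWeight L G (k - i) := by
    intro i hi
    have hc := capWeight_nonneg (L := L) hG1 (k - i)
    unfold profile
    split_ifs with h1
    · have hp : 0 ≤ φ' ((k - i) / L) := by
        cases (k - i) / L with
        | zero => rw [h0]; norm_num
        | succ m => rw [hsucc]; exact mul_nonneg hg (hφ m)
      refine (Nat.floor_le (by positivity)).trans ?_
      rw [mul_div_assoc]
      refine mul_le_mul_of_nonneg_left ?_ hD.le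
      rw [capWeight]
      refine div_le_div_of_nonneg_right ?_ (by positivity)
      refine (hφ' _ h1).trans ?_
      split_ifs with hq
      · rw [hq]; simp
      · obtain ⟨m, hm⟩ := Nat.exists_eq_succ_of_ne_zero hq
        rw [hm, Nat.succ_eq_add_one, Nat.add_sub_cancel, pow_succ, mul_comm]
        exact mul_le_mul_of_nonneg_left (pow_le_pow_left₀ (by linarith) hG2 m) (by linarith)
    · simp only [Nat.cast_zero]
      positivity
  have hfam := good_family (k := k) (d := d) (N := 2 ^ L)
    (f := fun p => if p < a then uniformVec μ s else profile k L Q D φ')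
    (fun p _ => by split_ifs <;> assumption) L ?_ 0 (by simp)
  · refine hfam.mono fun i hi => ?_
    by_cases hiL : i < L
    · simp [hiL]
    obtain ⟨j, rfl⟩ := Nat.exists_eq_add_of_le (not_lt.1 hiL)
    have hsum : ∑ p ∈ range (2 ^ L), (if p < a then uniformVec μ s else profile k L Q D φ') j =
        a * uniformVec μ s j + (2 ^ L - a) * profile k L Q D φ' j := by
      have : 2 ^ L = a + (2 ^ L - a) := by omega
      conv_lhs => rw [this, sum_range_add]
      rw [sum_congr rfl fun p hp => by rw [if_pos (mem_range.1 hp)]]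
      simp
    simp only [if_neg hiL, Nat.zero_add, Nat.add_sub_cancel_left]
    rw [hsum]
    have hkj : k - j = k - (L + j) + L := by omega
    have hdiv : (k - j) / L = (k - (L + j)) / L + 1 := by
      rw [hkj, Nat.add_div_right _ hL0]
    set t := k - (L + j) with ht
    have hu := hwin j (by omega)
    unfold profile uniformVec
    rw [← ht, hdiv]
    rw [hdiv] at hu
    rw [if_congr hu rfl rfl]
    -- Blocks before `Q` come from the copies of `φ'`, block `Q` from the uniform vectors, and later
    -- blocks are empty. Block 0 of `φ'` lies deeper than `k` below the root and is not counted,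
    -- which is why it can be refilled to 1.
    rcases lt_trichotomy (t / L) Q with hlt | heq | hgt
    · rw [if_neg (by omega), if_pos (by omega), if_pos (by omega), mul_zero, zero_add]
      refine Nat.le_floor ?_
      rw [hsucc, hkj]
      rw [Nat.cast_mul, Nat.cast_sub ha]
      push_cast
      have h1 : (⌊D * (g * φ (t / L)) / 2 ^ (t + L + 1)⌋₊ : ℝ) ≤
          D * (g * φ (t / L)) / 2 ^ (t + L + 1) :=
        Nat.floor_le (by have := hφ (t / L); positivity)
      have h2 : (0 : ℝ) ≤ 2 ^ L - a := by
        have : (a : ℝ) ≤ (2 ^ L : ℕ) := by exact_mod_cast ha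
        push_cast at this
        linarith
      calc ((2 : ℝ) ^ L - a) * ⌊D * (g * φ (t / L)) / 2 ^ (t + L + 1)⌋₊
          ≤ (2 ^ L - a) * (D * (g * φ (t / L)) / 2 ^ (t + L + 1)) := by gcongr
        _ = ((2 ^ L - a) * g) * (D * φ (t / L) / 2 ^ (t + L + 1)) := by ring
        _ ≤ 2 ^ L * (D * φ (t / L) / 2 ^ (t + L + 1)) := by
          have := hφ (t / L)
          gcongr
        _ = _ := by
          rw [show t + L + 1 = t + 1 + L by ring, pow_add 2 (t + 1) L]
          field_simp
    · rw [if_pos (by omega), if_neg (by omega), if_pos (by omega), mul_zero, add_zero, heq]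
      refine Nat.le_floor ?_
      rw [le_div_iff₀ (by positivity)]
      push_cast
      have h3 : (2 : ℝ) ^ (j - μ) * 2 ^ (t + 1) * (L * 2 ^ L) = 2 ^ (k + 1) := by
        rw [hLR, ← pow_add, ← pow_add, ← pow_add]
        congr 1
        have := (hwin j (by omega)).2 (by rw [hdiv, heq])
        omega
      have h4 : (0 : ℝ) < L * 2 ^ L := by rw [hLR]; positivity
      refine le_of_mul_le_mul_right ?_ h4
      calc (a : ℝ) * 2 ^ (j - μ) * 2 ^ (t + 1) * (L * 2 ^ L) = a * 2 ^ (k + 1) := by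
            rw [← h3]; ring
        _ ≤ D * φ Q * (L * 2 ^ L) := by linarith
    · rw [if_neg (by omega), if_neg (by omega), if_neg (by omega)]
      simp
  · intro h' hh' s' _
    have hb : ∀ p, ∀ i < k, (((if s' + p < a then uniformVec μ s else profile k L Q D φ') i : ℕ) : ℝ)
        ≤ D * capWeight L G (k - i) := by
      intro p i hi
      split_ifs
      · exact hcapT i hi
      · exact hcapB i hi
    have hrefl : ∑ i ∈ range (k - h'), capWeight L G (k - i) =
        ∑ t ∈ Ico (h' + 1) (k + 1), capWeight L G t := by
      have := sum_Ico_reflect (fun t => capWeight L G t) 0 (show k - h' ≤ k + 1 by omega)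
      rw [← range_eq_Ico] at this
      rw [this]
      congr 2
      omega
    have hr : ((∑ p ∈ range (2 ^ (h' + 1)), ∑ i ∈ range (k - h'),
        (if s' + p < a then uniformVec μ s else profile k L Q D φ') i : ℕ) : ℝ) ≤ d := by
      push_cast
      calc _ ≤ ∑ p ∈ range (2 ^ (h' + 1)), ∑ i ∈ range (k - h'), D * capWeight L G (k - i) :=
            sum_le_sum fun p _ => sum_le_sum fun i hi => hb p i (by have := mem_range.1 hi; omega)
        _ = D * (2 ^ (h' + 1) * ∑ t ∈ Ico (h' + 1) (k + 1), capWeight L G t) := by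
            rw [sum_const, ← mul_sum, hrefl, card_range, nsmul_eq_mul]
            push_cast
            ring
        _ ≤ D * (G * (1 + 2 / 2 ^ L)) :=
            mul_le_mul_of_nonneg_left (sum_capWeight_le hL2 hG1 hh' _ (by omega)) hD.le
        _ ≤ d := hd
    exact_mod_cast hr

theorem profile_congr {k L Q : ℕ} {D : ℝ} {φ ψ : ℕ → ℝ} (h : ∀ q ≤ Q, φ q = ψ q) :
    profile k L Q D φ = profile k L Q D ψ := by
  funext i
  unfold profile
  split_ifs with hi
  · rw [h _ hi]
  · rfl

/-- The parameters of the construction are large enough for `Good.of_step`. -/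
structure StepParams (k d L μ Q : ℕ) (D G : ℝ) : Prop where
  hL : L = 2 ^ μ
  hL2 : 2 ≤ L
  hQ : (Q + 3) * L ≤ k
  hD : 0 < D
  hG1 : 1 ≤ G
  hG2 : G ≤ 2
  hDQ : (2 : ℝ) ^ (k + 1) ≤ L * D * 2 ^ Q
  hd : D * (G * (1 + 2 / 2 ^ L)) ≤ d

/-- A profile of growth `β` can be turned into one of growth `g`. -/
theorem StepParams.good_pow {k d L μ Q a : ℕ} {D G β g : ℝ} (h : StepParams k d L μ Q D G)
    (hβ : 0 ≤ β) (hβg : β ≤ g) (hgG : g ≤ G) (ha : a ≤ 2 ^ L)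
    (hag : ((2 : ℝ) ^ L - a) * g ≤ 2 ^ L) (hcond : a * 2 ^ (k + 1) ≤ L * D * 2 ^ L * β ^ Q)
    (hg : Good k d (profile k L Q D fun q => g ^ q)) :
    Good k d (profile k L Q D fun q => β ^ q) := by
  -- `H j` grows by `g` over the first `j` blocks and by `β` afterwards. As `H (j + 1) (q + 1) = g *
  -- H j q`, one step leads from `H (j + 1)` to `H j`, and `Q + 1` steps replace all blocks up to
  -- `Q`.
  set H : ℕ → ℕ → ℝ := fun j q => if q < j then g ^ q else g ^ j * β ^ (q - j) with hH
  have hg0 : 0 ≤ g := hβ.trans hβg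
  have key : ∀ m j, j + m = Q + 1 → Good k d (profile k L Q D (H j)) := by
    intro m
    induction m with
    | zero =>
      intro j hj
      convert hg using 1
      exact profile_congr fun q hq => if_pos (by omega)
    | succ m ih =>
      intro j hj
      have hle : ∀ j q, H j q ≤ g ^ q := by
        intro j q
        simp only [hH]
        split_ifs with h1
        · exact le_refl _
        · calc g ^ j * β ^ (q - j) ≤ g ^ j * g ^ (q - j) := by gcongr
            _ = g ^ q := by rw [← pow_add]; congr 1; omega
      have hD := h.hD
      refine Good.of_step h.hL h.hL2 h.hQ h.hD h.hG1 h.hG2 hg0 ha hag (φ' := H (j + 1)) ?_ ?_ ?_ ?_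
        ?_ h.hDQ h.hd (ih (j + 1) (by omega))
      · intro q
        simp only [hH]
        split_ifs <;> positivity
      · simp [hH]
      · intro q
        simp only [hH, Nat.add_lt_add_iff_right, Nat.add_sub_add_right]
        split_ifs <;> ring
      · intro q _
        exact (hle _ _).trans (pow_le_pow_left₀ hg0 hgG q)
      · refine hcond.trans (mul_le_mul_of_nonneg_left ?_ (by positivity))
        simp only [hH]
        rw [if_neg (by omega)]
        calc β ^ Q = β ^ j * β ^ (Q - j) := by rw [← pow_add]; congr 1; omega
          _ ≤ g ^ j * β ^ (Q - j) := by gcongr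
  have := key (Q + 1) 0 (by omega)
  convert this using 1
  exact profile_congr fun q _ => by simp [hH]

/-- From the bottom of the tree upwards, the growth rate falls from `G` to 1 in decrements of `1 / 2
^ L`, then to 0, where only block 0 remains, and one more step removes that block. Setting aside a
fraction `x` of the nodes allows growth `1 + x` because `(1 - x) * (1 + x) ≤ 1`. -/
theorem StepParams.good_zero {k d L μ Q n : ℕ} {D G : ℝ} (h : StepParams k d L μ Q D G)
    (hn : n ≤ 2 ^ L) (hG : G = 1 + n / 2 ^ L)
    (hcond : ∀ a < n, ((a : ℝ) + 1) * 2 ^ (k + 1) ≤ L * D * 2 ^ L * (1 + a / 2 ^ L) ^ Q)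
    (hfin : Good k d (profile k L Q D fun q => G ^ q)) : Good k d 0 := by
  have hpow : (0 : ℝ) < 2 ^ L := by positivity
  have hD := h.hD
  have h1 : ∀ m a, a + m = n → Good k d (profile k L Q D fun q => (1 + a / 2 ^ L : ℝ) ^ q) := by
    intro m
    induction m with
    | zero =>
      intro a ha
      have : a = n := by omega
      rwa [this, ← hG]
    | succ m ih =>
      intro a ha
      have hc := hcond a (by omega)
      refine h.good_pow (g := 1 + (a + 1 : ℕ) / 2 ^ L) (a := a + 1) (by positivity) ?_ ?_ (by omega)
        ?_ ?_ (ih (a + 1) (by omega))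
      · push_cast; gcongr; linarith
      · rw [hG]
        have : ((a + 1 : ℕ) : ℝ) ≤ n := by exact_mod_cast (by omega : a + 1 ≤ n)
        gcongr
      · have : ((2 : ℝ) ^ L - (a + 1 : ℕ)) * (1 + (a + 1 : ℕ) / 2 ^ L) =
          2 ^ L - ((a + 1 : ℕ) : ℝ) ^ 2 / 2 ^ L := by
          field_simp; ring
        rw [this]
        have : (0 : ℝ) ≤ ((a + 1 : ℕ) : ℝ) ^ 2 / 2 ^ L := by positivity
        linarith
      · push_cast; exact hc
  have h2 := h1 n 0 (by omega)
  have h3 : Good k d (profile k L Q D fun q => (0 : ℝ) ^ q) := by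
    refine h.good_pow (g := 1) (a := 0) le_rfl (by norm_num) h.hG1 (by simp) (by simp) ?_ ?_
    · simp only [Nat.cast_zero, zero_mul]; positivity
    · simpa using h2
  have h4 : Good k d (profile k L Q D fun _ => 0) := by
    refine Good.of_step h.hL h.hL2 h.hQ h.hD h.hG1 h.hG2 (g := 1) (a := 0) (by norm_num) (by simp)
      (by simp) (by simp) (pow_zero _) ?_ ?_ (by simp) h.hDQ h.hd h3
    · intro q; simp
    · intro q _
      have := h.hG1
      exact pow_le_pow_left₀ le_rfl (by linarith) q
  convert h4 using 1
  funext i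
  simp [profile]

/-! ### Choice of parameters and the resulting formulas. -/

theorem exp_one_mul_le_one_add_pow {x : ℝ} (hx : 0 ≤ x) {n : ℕ} :
    Real.exp 1 * (((n : ℝ) - 1) * x) ≤ (1 + x) ^ n := by
  cases n with
  | zero =>
    have := Real.exp_pos 1
    simp
    nlinarith [mul_nonneg this.le hx]
  | succ n =>
    have h1 : Real.exp (x / (1 + x)) ≤ 1 + x := by
      have h2 := Real.add_one_le_exp (-(x / (1 + x)))
      have h3 : -(x / (1 + x)) + 1 = (1 + x)⁻¹ := by field_simp; ring
      rw [h3, Real.exp_neg] at h2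
      exact (inv_le_inv₀ (by positivity) (by positivity)).1 h2
    -- This is `e * y ≤ exp y` at `y = n * (x / (1 + x))`. One further factor `1 + x` clears the
    -- denominator, hence the loss of one in the exponent.
    have h4 : Real.exp 1 * (n * (x / (1 + x))) ≤ (1 + x) ^ n :=
      calc Real.exp 1 * (n * (x / (1 + x)))
          ≤ Real.exp 1 * Real.exp (n * (x / (1 + x)) - 1) := by
            gcongr
            linarith [Real.add_one_le_exp (n * (x / (1 + x)) - 1)]
        _ = Real.exp (x / (1 + x)) ^ n := by
            rw [← Real.exp_add, ← Real.exp_nat_mul]; congr 1; ring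
        _ ≤ _ := by gcongr
    calc _ = Real.exp 1 * (n * (x / (1 + x))) * (1 + x) := by push_cast; field_simp; ring
      _ ≤ (1 + x) ^ n * (1 + x) := by gcongr
      _ = _ := by rw [pow_succ]

theorem eight_mul_sq_le_two_pow {n : ℕ} (h : 10 ≤ n) : 8 * n ^ 2 ≤ 2 ^ n := by
  induction n, h using Nat.le_induction with
  | base => norm_num
  | succ m hm ih => rw [pow_succ 2 m]; nlinarith

set_option maxHeartbeats 1000000 in
/-- Every large enough `d` of the claimed order admits a tree without leaves at depth less
than `k`. -/
theorem good_zero_of_le {k d μ : ℕ} (hμ : 7 ≤ μ) (hk1 : 4 ^ μ ≤ k) (hk2 : k < 4 ^ (μ + 1))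
    (hd : (2 : ℝ) ^ (k + 1) / (Real.exp 1 * k) * (1 + 21 / 2 ^ μ) *
      ((1 + 128 / 2 ^ μ) * (1 + 2 / 2 ^ (2 ^ μ))) ≤ d) : Good k d 0 := by
  obtain ⟨L, hL⟩ : ∃ L, L = 2 ^ μ := ⟨_, rfl⟩
  have hLR : (2 : ℝ) ^ μ = L := by rw [hL]; push_cast; rfl
  rw [hLR, ← hL] at hd
  have h4 : 4 ^ μ = L * L := by rw [hL, ← mul_pow]; norm_num
  have hkL : L * L ≤ k := h4 ▸ hk1
  have hkL' : k < 4 * (L * L) := by rw [← h4]; rw [pow_succ] at hk2; omega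
  have hL128 : 128 ≤ L := by
    rw [hL]
    calc 128 = 2 ^ 7 := by norm_num
      _ ≤ 2 ^ μ := Nat.pow_le_pow_right (by norm_num) hμ
  have hμL : μ < L := hL ▸ Nat.lt_two_pow_self
  have hL0 : 0 < L := by omega
  have hLr : (128 : ℝ) ≤ L := by exact_mod_cast hL128
  have hkr1 : (L : ℝ) * L ≤ k := by exact_mod_cast hkL
  have hkr2 : (k : ℝ) < 4 * (L * L) := by exact_mod_cast hkL'
  have hk0 : (0 : ℝ) < k := by nlinarith
  obtain ⟨Q, hQ⟩ : ∃ Q, Q + 3 = k / L :=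
    ⟨k / L - 3, by have : L ≤ k / L := (Nat.le_div_iff_mul_le hL0).2 hkL; omega⟩
  have hQ1 : (Q + 3) * L ≤ k := by rw [hQ]; exact Nat.div_mul_le_self _ _
  have hQ2 : k < (Q + 4) * L := by
    rw [← Nat.div_lt_iff_lt_mul hL0]
    omega
  have hQL : L ≤ Q + 3 := by rw [hQ]; exact (Nat.le_div_iff_mul_le hL0).2 hkL
  have he := Real.exp_one_lt_d9
  have he0 := Real.exp_pos 1
  have h2L : (8 : ℝ) * L ^ 2 ≤ 2 ^ L := by exact_mod_cast eight_mul_sq_le_two_pow (by omega)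
  -- Here `21 = 10 + 11`: the `10` comes from `k ≤ (L + 10) * (Q - 1)`, the `11` from `e * k ≤ 11 *
  -- 2 ^ L`, which handles the `+ 1` in `a + 1`.
  set D : ℝ := 2 ^ (k + 1) / (Real.exp 1 * k) * (1 + 21 / L) with hD
  have hD0 : 0 < D := by positivity
  have hDe : D * (Real.exp 1 * k) * L = 2 ^ (k + 1) * (L + 21) := by
    rw [hD]; field_simp
  have hDlow : (2 : ℝ) ^ (k + 1) ≤ D * (Real.exp 1 * k) := by
    have : D * (Real.exp 1 * k) = 2 ^ (k + 1) * (1 + 21 / L) := by rw [hD]; field_simp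
    rw [this]
    refine le_mul_of_one_le_right (by positivity) ?_
    have : (0 : ℝ) ≤ 21 / L := by positivity
    linarith
  have hDlow' : (2 : ℝ) ^ (k + 1) ≤ D * (11 * (L * L)) := by
    refine hDlow.trans (mul_le_mul_of_nonneg_left ?_ hD0.le)
    nlinarith
  set G : ℝ := 1 + 128 / L with hG
  have hG1 : 1 ≤ G := by have : (0 : ℝ) ≤ 128 / L := by positivity
                         linarith
  have hdD : D ≤ d := by
    refine le_trans ?_ hd
    have h1 : (0 : ℝ) ≤ 2 / 2 ^ L := by positivity
    have h2 : 1 ≤ G * (1 + 2 / 2 ^ L) := by nlinarith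
    nlinarith
  have hpar : StepParams k d L μ Q D G := by
    refine ⟨hL, by omega, hQ1, hD0, hG1, ?_, ?_, hd⟩
    · have : (128 : ℝ) / L ≤ 1 := by rw [div_le_one (by positivity)]; exact hLr
      linarith
    · have h1 : 11 * (L : ℝ) ≤ 2 ^ Q := by
        have h3 : (2 : ℝ) ^ L ≤ 2 ^ (Q + 3) := pow_le_pow_right₀ (by norm_num) hQL
        rw [pow_add] at h3
        nlinarith
      calc _ ≤ D * (11 * (L * L)) := hDlow'
        _ = L * D * (11 * L) := by ring
        _ ≤ _ := by gcongr
  have hn : ((2 ^ (L - μ + 7) : ℕ) : ℝ) / 2 ^ L = 128 / L := by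
    rw [div_eq_div_iff (by positivity) (by positivity), ← hLR]
    push_cast
    rw [← pow_add, show (128 : ℝ) = 2 ^ 7 by norm_num, ← pow_add]
    congr 1
    omega
  refine hpar.good_zero (n := 2 ^ (L - μ + 7)) (Nat.pow_le_pow_right (by norm_num) (by omega))
    (by rw [hn]) ?_ ?_
  · intro a _
    set x : ℝ := a / 2 ^ L with hx
    have hx0 : 0 ≤ x := by positivity
    have hax : (a : ℝ) = x * 2 ^ L := by rw [hx]; field_simp
    have hb1 : (1 : ℝ) ≤ (1 + x) ^ Q := one_le_pow₀ (by linarith)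
    have hb2 := exp_one_mul_le_one_add_pow hx0 (n := Q)
    have hQr : (k : ℝ) ≤ (Q + 4) * L := by exact_mod_cast hQ2.le
    have hQLr : (L : ℝ) ≤ Q + 3 := by exact_mod_cast hQL
    -- The constant `e` enters here, through `e * (Q - 1) * x ≤ (1 + x) ^ Q`, which holds for all
    -- growth rates at once.
    have key : ((a : ℝ) + 1) * (Real.exp 1 * k) ≤ (L + 21) * 2 ^ L * (1 + x) ^ Q := by
      have hm1 : Real.exp 1 * k ≤ 11 * 2 ^ L * (1 + x) ^ Q := by
        calc Real.exp 1 * k ≤ 11 * 2 ^ L := by nlinarith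
          _ ≤ _ := le_mul_of_one_le_right (by positivity) hb1
      have hm2 : (a : ℝ) * (Real.exp 1 * k) ≤ (L + 10) * 2 ^ L * (1 + x) ^ Q := by
        rw [hax]
        have h6 : (k : ℝ) ≤ (L + 10) * (Q - 1) := by nlinarith
        calc x * 2 ^ L * (Real.exp 1 * k) ≤ x * 2 ^ L * (Real.exp 1 * ((L + 10) * (Q - 1))) := by
              gcongr
          _ = (L + 10) * 2 ^ L * (Real.exp 1 * ((Q - 1) * x)) := by ring
          _ ≤ _ := by gcongr
      linarith
    have hpos : 0 < Real.exp 1 * k := by positivity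
    refine le_of_mul_le_mul_right ?_ hpos
    calc _ = 2 ^ (k + 1) * (((a : ℝ) + 1) * (Real.exp 1 * k)) := by ring
      _ ≤ 2 ^ (k + 1) * ((L + 21) * 2 ^ L * (1 + x) ^ Q) := by gcongr
      _ = (D * (Real.exp 1 * k) * L) * (2 ^ L * (1 + x) ^ Q) := by rw [hDe]; ring
      _ = _ := by ring
  -- Growth `G` leaves room for a uniform vector on the `L ^ 2 / 4` levels from `3 * L` on. They lie
  -- in blocks `q` with `L / 2 - 1 ≤ q ≤ Q`, where `G ^ q ≥ 44`, and `2 ^ (k + 1) ≤ D * 11 * L ^ 2 =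
  -- 44 * D * (L ^ 2 / 4)`.
  · have hM : 2 ^ (2 * μ - 2) * 4 = L * L := by
      rw [← h4, show (4 : ℕ) = 2 ^ 2 by norm_num, ← pow_add, ← pow_mul]
      congr 1
      omega
    have hMr : (2 : ℝ) ^ (2 * μ - 2) * 4 = L * L := by exact_mod_cast hM
    have hLL : 128 * L ≤ L * L := Nat.mul_le_mul_right _ hL128
    have hT : Good k d (uniformVec (2 * μ - 2) (3 * L)) := by
      refine good_uniformVec (by omega) ?_
      have h5 : (2 : ℝ) ^ (3 * L - (2 * μ - 2) + 2 ^ (2 * μ - 2)) ≤ D := by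
        have h6 : (2 : ℝ) ^ (3 * L - (2 * μ - 2) + 2 ^ (2 * μ - 2)) * (11 * (L * L)) ≤
            2 ^ (k + 1) := by
          calc _ ≤ (2 : ℝ) ^ (3 * L - (2 * μ - 2) + 2 ^ (2 * μ - 2)) * (2 ^ 4 * 2 ^ (2 * μ)) := by
                have : (2 : ℝ) ^ (2 * μ) = L * L := by
                  rw [pow_mul, ← hLR, ← mul_pow]; norm_num
                rw [this]
                gcongr
                norm_num
            _ = 2 ^ (3 * L - (2 * μ - 2) + 2 ^ (2 * μ - 2) + (4 + 2 * μ)) := by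
                rw [← pow_add, ← pow_add]
            _ ≤ _ := pow_le_pow_right₀ (by norm_num) (by omega)
        refine le_of_mul_le_mul_right (h6.trans hDlow') (by positivity)
      exact_mod_cast h5.trans hdD
    refine hT.mono fun i hi => ?_
    unfold uniformVec
    split_ifs with hw
    · have hi1 : (k - i) / L ≤ Q := by
        rw [← Nat.lt_succ_iff, Nat.div_lt_iff_lt_mul hL0, Nat.succ_eq_add_one, add_mul]
        rw [add_mul] at hQ2
        omega
      have hi2 : L ≤ 2 * ((k - i) / L + 1) := by
        have h7 : k - i < L * ((k - i) / L + 1) := Nat.lt_mul_div_succ _ hL0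
        have h8 : L * L ≤ 2 * (k - i) := by omega
        have h9 : L * L < L * (2 * ((k - i) / L + 1)) := by
          calc L * L ≤ 2 * (k - i) := h8
            _ < 2 * (L * ((k - i) / L + 1)) := by omega
            _ = _ := by ring
        exact (Nat.lt_of_mul_lt_mul_left h9).le
      rw [profile, if_pos hi1]
      refine Nat.le_floor ?_
      rw [le_div_iff₀ (by positivity)]
      set q := (k - i) / L
      have hG44 : 44 ≤ G ^ q := by
        have h10 := one_add_mul_le_pow (a := (128 : ℝ) / L)
          (by have : (0 : ℝ) ≤ 128 / L := by positivity
              linarith) q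
        refine le_trans ?_ h10
        have h11 : (L : ℝ) ≤ 2 * (q + 1) := by exact_mod_cast hi2
        have h12 : 43 * (L : ℝ) ≤ q * 128 := by nlinarith
        have h13 : 43 ≤ (q : ℝ) * (128 / L) := by
          rw [mul_div_assoc', le_div_iff₀ (by positivity)]
          exact h12
        linarith
      have h14 : (2 : ℝ) ^ (i - (2 * μ - 2)) * 2 ^ (k - i + 1) * 2 ^ (2 * μ - 2) = 2 ^ (k + 1) := by
        rw [← pow_add, ← pow_add]
        congr 1
        omega
      refine le_of_mul_le_mul_right ?_ (show (0 : ℝ) < 2 ^ (2 * μ - 2) by positivity)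
      push_cast
      rw [h14]
      calc _ ≤ D * (11 * (L * L)) := hDlow'
        _ = D * 44 * 2 ^ (2 * μ - 2) := by rw [← hMr]; ring
        _ ≤ _ := by gcongr
    · exact Nat.zero_le _

theorem exists_formula_of_good {k d : ℕ} (hk : 1 ≤ k) (h : Good k d 0) :
    ∃ F : CNF, CNF.IsKSCNF k d F ∧ CNF.IsMU1 F := by
  obtain ⟨T, h1, h2⟩ := h
  exact ⟨_, treeFormula_spec hk h1 fun i hi => Nat.le_zero.1 (h2 i hi)⟩

theorem good_zero_two_pow (k : ℕ) : Good k (2 ^ k) 0 :=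
  (good_complete (n := k) le_rfl).mono fun i hi => by simp [hi.ne]

theorem exists_mu1_formula : ∃ C : ℝ, 0 ≤ C ∧ ∀ k : ℕ, 1 ≤ k →
    ∃ (s : ℕ) (F : CNF), CNF.IsKSCNF k s F ∧ CNF.IsMU1 F ∧
      (s : ℝ) ≤ ((Real.exp 1)⁻¹ + C * (k : ℝ) ^ (-(1 / 2 : ℝ))) * ((2 : ℝ) ^ (k + 1) / k) := by
  -- For `k < 4 ^ 7` complete trees suffice, as `√k * k ≤ 4 ^ 14`; for larger `k` only `2 * 8514 +
  -- 1` is needed.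
  refine ⟨4 ^ 14, by positivity, fun k hk => ?_⟩
  have hk0 : (0 : ℝ) < k := by exact_mod_cast hk
  have hk1 : (1 : ℝ) ≤ k := by exact_mod_cast hk
  have hsq : (k : ℝ) ^ (-(1 / 2 : ℝ)) = (√k)⁻¹ := by rw [Real.rpow_neg hk0.le, Real.sqrt_eq_rpow]
  rw [hsq]
  have hs1 : 1 ≤ √(k : ℝ) := by rw [Real.one_le_sqrt]; exact hk1
  have hss : √(k : ℝ) * √k = k := Real.mul_self_sqrt hk0.le
  have hsk : √(k : ℝ) ≤ k := by nlinarith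
  by_cases hk7 : k < 4 ^ 7
  · obtain ⟨F, hF⟩ := exists_formula_of_good hk (good_zero_two_pow k)
    refine ⟨2 ^ k, F, hF.1, hF.2, ?_⟩
    have h1 : (k : ℝ) ≤ 4 ^ 7 := by exact_mod_cast hk7.le
    have h2 : √(k : ℝ) * k ≤ 4 ^ 14 := by nlinarith
    have h3 : 0 ≤ (Real.exp 1)⁻¹ * (2 ^ (k + 1) / k) := by positivity
    have h4 : (2 : ℝ) ^ k ≤ 4 ^ 14 * (√(k : ℝ))⁻¹ * (2 ^ (k + 1) / k) := by
      rw [← div_eq_mul_inv, div_mul_div_comm, le_div_iff₀ (by positivity), pow_succ 2 k]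
      nlinarith [pow_pos (show (0 : ℝ) < 2 by norm_num) k]
    push_cast
    linarith
  · push Not at hk7
    set μ := Nat.log 4 k with hμ
    have hm1 : 4 ^ μ ≤ k := Nat.pow_log_le_self 4 (by omega)
    have hm2 : k < 4 ^ (μ + 1) := Nat.lt_pow_succ_log_self (by norm_num) k
    have hm3 : 7 ≤ μ := Nat.le_log_of_pow_le (by norm_num) hk7
    set A : ℝ := (2 : ℝ) ^ (k + 1) / (Real.exp 1 * k) with hA
    have hA0 : 0 < A := by positivity
    obtain ⟨F, hF⟩ := exists_formula_of_good hk
      (good_zero_of_le hm3 hm1 hm2 (Nat.le_ceil _))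
    refine ⟨_, F, hF.1, hF.2, ?_⟩
    refine (Nat.ceil_lt_add_one (by positivity)).le.trans ?_
    set y : ℝ := 1 / 2 ^ μ with hy
    have hy0 : 0 ≤ y := by positivity
    have hpow1 : (1 : ℝ) ≤ 2 ^ μ := one_le_pow₀ (by norm_num)
    have hy1 : y ≤ 1 := by rw [hy, div_le_one (by positivity)]; exact hpow1
    have hyk : y ≤ 2 * (√(k : ℝ))⁻¹ := by
      rw [hy, ← div_eq_mul_inv, div_le_div_iff₀ (by positivity) (by positivity), one_mul]
      have h5 : √(k : ℝ) ≤ √((2 * 2 ^ μ) ^ 2) := by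
        apply Real.sqrt_le_sqrt
        have : (k : ℝ) ≤ 4 ^ (μ + 1) := by exact_mod_cast hm2.le
        refine this.trans (le_of_eq ?_)
        rw [mul_pow, ← pow_mul, mul_comm μ 2, pow_mul]
        norm_num
        ring
      rwa [Real.sqrt_sq (by positivity)] at h5
    have hexp : (2 : ℝ) / 2 ^ (2 ^ μ) ≤ 2 * y := by
      rw [hy, mul_one_div]
      have : (2 : ℝ) ^ μ ≤ 2 ^ 2 ^ μ :=
        pow_le_pow_right₀ (by norm_num) Nat.lt_two_pow_self.le
      gcongr
    -- Higher powers of `y ≤ 1` are bounded by `y`, and `8514 = 22 * 129 * 3` bounds the sum of the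
    -- coefficients.
    have hprod : A * (1 + 21 / 2 ^ μ) * ((1 + 128 / 2 ^ μ) * (1 + 2 / 2 ^ (2 ^ μ))) ≤
        A * (1 + 8514 * y) := by
      rw [mul_assoc]
      refine mul_le_mul_of_nonneg_left ?_ hA0.le
      have e1 : (21 : ℝ) / 2 ^ μ = 21 * y := by rw [hy]; ring
      have e2 : (128 : ℝ) / 2 ^ μ = 128 * y := by rw [hy]; ring
      rw [e1, e2]
      calc _ ≤ (1 + 21 * y) * ((1 + 128 * y) * (1 + 2 * y)) := by gcongr
        _ ≤ _ := by nlinarith [mul_nonneg hy0 hy0, mul_nonneg (mul_nonneg hy0 hy0) hy0,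
            mul_le_mul_of_nonneg_left hy1 hy0, mul_le_mul_of_nonneg_left hy1 (mul_nonneg hy0 hy0)]
    have hAB : A ≤ 2 ^ (k + 1) / k := by
      rw [hA]
      refine div_le_div_of_nonneg_left (by positivity) hk0 ?_
      exact le_mul_of_one_le_left hk0.le (Real.one_le_exp (by norm_num))
    have hA2 : A = (Real.exp 1)⁻¹ * (2 ^ (k + 1) / k) := by rw [hA]; field_simp
    have hone : 1 ≤ (√(k : ℝ))⁻¹ * (2 ^ (k + 1) / k) := by
      rw [← div_eq_inv_mul, div_div, one_le_div (by positivity)]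
      have h6 : (8 : ℝ) * k ^ 2 ≤ 2 ^ k := by exact_mod_cast eight_mul_sq_le_two_pow (by
        have : 10 ≤ 4 ^ 7 := by norm_num
        omega)
      rw [pow_succ]
      nlinarith
    set B : ℝ := 2 ^ (k + 1) / k with hB
    have hB0 : 0 < B := by positivity
    set z := (√(k : ℝ))⁻¹
    have hz : 0 ≤ z := by positivity
    calc _ ≤ A * (1 + 8514 * y) + 1 := by linarith
      _ ≤ A + A * (8514 * (2 * z)) + z * B := by
        have : A * (8514 * y) ≤ A * (8514 * (2 * z)) := by gcongr
        linarith
      _ ≤ A + B * (8514 * (2 * z)) + z * B := by gcongr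
      _ ≤ _ := by rw [hA2]; nlinarith [mul_nonneg hz hB0.le]

/-! ### The lopsided local lemma, by weighted counting of assignments. -/

section LopsidedLocalLemma

variable {N : ℕ} {p : Literal → ℝ}

/-- Extension of a truth assignment of the first `N` variables. -/
def extendAssignment (a : Fin N → Bool) (v : ℕ) : Bool := if h : v < N then a ⟨v, h⟩ else true

theorem extendAssignment_update (a : Fin N → Bool) {v : ℕ} (hv : v < N) (b : Bool) :
    extendAssignment (Function.update a ⟨v, hv⟩ b) = Function.update (extendAssignment a) v b := by
  funext u
  unfold extendAssignment
  by_cases hu : u < N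
  · by_cases huv : u = v
    · subst huv; simp [hu]
    · rw [Function.update_of_ne huv, dif_pos hu, dif_pos hu, Function.update_of_ne]
      simpa [Fin.ext_iff] using huv
  · rw [dif_neg hu, Function.update_of_ne (by omega), dif_neg hu]

/-- The weight of an assignment, when the literal `l` is true with probability `p l`. -/
def assignmentWeight (p : Literal → ℝ) (a : Fin N → Bool) : ℝ := ∏ v : Fin N, p (v, a v)

open Classical in
/-- The probability of a set of assignments, when the first `N` variables are chosen
independently and the literal `l` is true with probability `p l`. -/
noncomputable def prob (N : ℕ) (p : Literal → ℝ) (B : Set (ℕ → Bool)) : ℝ :=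
  ∑ a : Fin N → Bool with extendAssignment a ∈ B, assignmentWeight p a

theorem assignmentWeight_nonneg (hp : ∀ l, 0 ≤ p l) (a : Fin N → Bool) :
    0 ≤ assignmentWeight p a := prod_nonneg fun _ _ => hp _

theorem prob_mono (hp : ∀ l, 0 ≤ p l) {A B : Set (ℕ → Bool)} (h : A ⊆ B) :
    prob N p A ≤ prob N p B := by
  classical
  refine sum_le_sum_of_subset_of_nonneg ?_ fun a _ _ => assignmentWeight_nonneg hp a
  intro a ha
  rw [mem_filter] at ha ⊢
  exact ⟨ha.1, h ha.2⟩

theorem prob_univ (hp1 : ∀ v, p (v, true) + p (v, false) = 1) : prob N p Set.univ = 1 := by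
  classical
  simp only [prob, Set.mem_univ, filter_true, assignmentWeight]
  have := prod_univ_sum (fun _ : Fin N => (univ : Finset Bool)) (fun v b => p (v, b))
  rw [Fintype.piFinset_univ] at this
  rw [← this]
  simp [hp1]

theorem prob_add_prob (A B : Set (ℕ → Bool)) :
    prob N p (B ∩ A) + prob N p (B ∩ Aᶜ) = prob N p B := by
  classical
  simp only [prob]
  rw [← sum_filter_add_sum_filter_not (univ.filter fun a => extendAssignment a ∈ B)
    (fun a => extendAssignment a ∈ A)]
  congr 1 <;> exact sum_congr (by ext; simp) fun _ _ => rfl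

/-- Making `l` true maps the part of `B` where `l` is false injectively into the part where it is
true, and trades a factor `1 - p l` of the weight for `p l`. -/
theorem prob_false_inter_le (hp : ∀ l, 0 ≤ p l) (hp1 : ∀ v, p (v, true) + p (v, false) = 1)
    {B : Set (ℕ → Bool)} {l : Literal} (hl : l.1 < N)
    (hB : ∀ a ∈ B, Function.update a l.1 l.2 ∈ B) :
    prob N p (B ∩ {a | a l.1 = l.2}ᶜ) ≤ (1 - p l) * prob N p B := by
  classical
  obtain ⟨v, b⟩ := l
  simp only at hl hB ⊢
  have hpb : p (v, !b) = 1 - p (v, b) := by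
    have := hp1 v
    cases b <;> simp <;> linarith
  have key : ∀ A A' : Set (ℕ → Bool), A = B ∩ {a | a v = b} → A' = B ∩ {a | a v = b}ᶜ →
      p (v, b) * prob N p A' ≤ (1 - p (v, b)) * prob N p A := by
    intro A A' hA hA'
    simp only [prob]
    rw [mul_sum, mul_sum]
    have hval : ∀ a : Fin N → Bool, extendAssignment a v = a ⟨v, hl⟩ := fun a => dif_pos hl
    have hmem : ∀ a : Fin N → Bool, extendAssignment a ∈ A' → a ⟨v, hl⟩ = !b := by
      intro a ha
      rw [hA'] at ha
      have := ha.2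
      simp only [Set.mem_compl_iff, Set.mem_ofPred_eq, hval] at this
      cases h : a ⟨v, hl⟩ <;> cases b <;> simp_all
    have hw : ∀ a : Fin N → Bool, a ⟨v, hl⟩ = !b → p (v, b) * assignmentWeight p a =
        (1 - p (v, b)) * assignmentWeight p (Function.update a ⟨v, hl⟩ b) := by
      intro a ha
      unfold assignmentWeight
      rw [← mul_prod_erase univ _ (mem_univ (⟨v, hl⟩ : Fin N)),
        ← mul_prod_erase univ (fun u : Fin N => p (u, Function.update a ⟨v, hl⟩ b u))
          (mem_univ (⟨v, hl⟩ : Fin N))]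
      have hprod : ∏ u ∈ univ.erase (⟨v, hl⟩ : Fin N), p (u, Function.update a ⟨v, hl⟩ b u) =
          ∏ u ∈ univ.erase (⟨v, hl⟩ : Fin N), p (u, a u) :=
        prod_congr rfl fun u hu => by rw [Function.update_of_ne (ne_of_mem_erase hu)]
      rw [hprod]
      simp only [ha, Function.update_self, hpb]
      ring
    refine (sum_congr rfl fun a ha => hw a (hmem a (mem_filter.1 ha).2)).trans_le ?_
    refine (sum_image (f := fun a => (1 - p (v, b)) * assignmentWeight p a)
      (g := fun a : Fin N → Bool => Function.update a ⟨v, hl⟩ b) ?_).symm.trans_le ?_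
    · intro a ha a' ha' h
      have h1 := hmem a (mem_filter.1 ha).2
      have h2 := hmem a' (mem_filter.1 ha').2
      funext u
      by_cases hu : u = ⟨v, hl⟩
      · rw [hu, h1, h2]
      · have := congrFun h u
        simpa [Function.update_of_ne hu] using this
    · refine sum_le_sum_of_subset_of_nonneg ?_ fun a _ _ =>
        mul_nonneg (hpb ▸ hp _) (assignmentWeight_nonneg hp a)
      intro a ha
      obtain ⟨a', ha', rfl⟩ := mem_image.1 ha
      have ha₁ := (mem_filter.1 ha').2
      rw [hA'] at ha₁
      rw [mem_filter, extendAssignment_update, hA]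
      exact ⟨mem_univ _, hB _ ha₁.1, by simp⟩
  rw [← prob_add_prob (N := N) (p := p) {a | a v = b} B]
  linarith [key _ _ rfl rfl]

/-- A clause without complementary literals. -/
def Clause.Consistent (C : Clause) : Prop := ∀ l ∈ C, ∀ l' ∈ C, l.1 = l'.1 → l = l'

/-- Literals are falsified one by one. Making `l` true does not disturb the falsity of the others,
since a consistent clause has no second literal on that variable. -/
theorem prob_all_false_inter_le (hp : ∀ l, 0 ≤ p l) (hp1 : ∀ v, p (v, true) + p (v, false) = 1)
    {B : Set (ℕ → Bool)} {C : Clause} (hC : Clause.Consistent C) (hN : ∀ l ∈ C, l.1 < N)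
    (hB : ∀ l ∈ C, ∀ a ∈ B, Function.update a l.1 l.2 ∈ B) :
    prob N p (B ∩ {a | Clause.SatisfiedBy C a}ᶜ) ≤ (∏ l ∈ C, (1 - p l)) * prob N p B := by
  induction C using Finset.induction_on with
  | empty =>
    rw [prod_empty, one_mul]
    exact prob_mono hp Set.inter_subset_left
  | insert l C hl ih =>
    have ih := ih (fun l hl l' hl' => hC l (mem_insert_of_mem hl) l' (mem_insert_of_mem hl'))
      (fun l hl => hN l (mem_insert_of_mem hl)) (fun l hl => hB l (mem_insert_of_mem hl))
    have h1 : B ∩ {a | Clause.SatisfiedBy (insert l C) a}ᶜ =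
        (B ∩ {a | Clause.SatisfiedBy C a}ᶜ) ∩ {a | a l.1 = l.2}ᶜ := by
      ext a
      simp only [Clause.SatisfiedBy, Set.mem_inter_iff, Set.mem_compl_iff, Set.mem_ofPred_eq,
        mem_insert, exists_eq_or_imp]
      exact ⟨fun h => ⟨⟨h.1, fun h' => h.2 (Or.inr h')⟩, fun h' => h.2 (Or.inl h')⟩,
        fun h => ⟨h.1.1, fun h' => h'.elim h.2 h.1.2⟩⟩
    have h2 : 0 ≤ 1 - p l := by
      have h3 := hp1 l.1
      have h4 := hp (l.1, true)
      have h5 := hp (l.1, false)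
      obtain ⟨v, _ | _⟩ := l <;> simp at * <;> linarith
    rw [h1, prod_insert hl, mul_assoc]
    refine (prob_false_inter_le hp hp1 (hN l (mem_insert_self _ _)) ?_).trans
      (mul_le_mul_of_nonneg_left ih h2)
    rintro a ⟨ha1, ha2⟩
    refine ⟨hB l (mem_insert_self _ _) a ha1, ?_⟩
    rintro ⟨l', hl', h⟩
    refine ha2 ⟨l', hl', ?_⟩
    rwa [Function.update_of_ne] at h
    intro heq
    exact hl (hC l' (mem_insert_of_mem hl') l (mem_insert_self _ _) heq ▸ hl')

/-- Two clauses conflict if some literal of the first is negated in the second. -/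
def Clause.Conflicts (C D : Clause) : Prop := ∃ l ∈ C, (l.1, !l.2) ∈ D

/-- The set of assignments that satisfy all clauses of a formula. -/
def satAssignments (S : CNF) : Set (ℕ → Bool) := {a | ∀ C ∈ S, Clause.SatisfiedBy C a}

theorem satAssignments_insert (S : CNF) (C : Clause) :
    satAssignments (insert C S) = satAssignments S ∩ {a | Clause.SatisfiedBy C a} := by
  ext a
  simp [satAssignments, and_comm]

/-- If every clause of `F` is unlikely to be false given a subformula with fewer than `n`
clauses, then adding clauses does not decrease the probability much. -/
theorem pow_mul_prob_le {F : CNF} {x : ℝ} (hx1 : x ≤ 1) {n : ℕ}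
    (ih : ∀ S ⊆ F, S.card < n → ∀ C ∈ F,
      prob N p (satAssignments S ∩ {a | Clause.SatisfiedBy C a}ᶜ) ≤
        x * prob N p (satAssignments S))
    (S T : CNF) (hS : S ⊆ F) (hT : T ⊆ F) (hd : Disjoint S T) (hn : S.card + T.card ≤ n) :
    (1 - x) ^ T.card * prob N p (satAssignments S) ≤ prob N p (satAssignments (S ∪ T)) := by
  induction T using Finset.induction_on with
  | empty => simp
  | insert D T hD ihT =>
    rw [card_insert_of_notMem hD] at hn ⊢
    have h1 := ihT ((subset_insert _ _).trans hT) (hd.mono_right (subset_insert _ _)) (by omega)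
    have h2 := ih (S ∪ T) (union_subset hS ((subset_insert _ _).trans hT))
      ((card_union_le _ _).trans_lt (by omega)) D (hT (mem_insert_self _ _))
    rw [union_insert, satAssignments_insert]
    have h3 := prob_add_prob (N := N) (p := p) {a | Clause.SatisfiedBy D a} (satAssignments (S ∪ T))
    calc _ = (1 - x) * ((1 - x) ^ T.card * prob N p (satAssignments S)) := by rw [pow_succ]; ring
      _ ≤ (1 - x) * prob N p (satAssignments (S ∪ T)) :=
          mul_le_mul_of_nonneg_left h1 (by linarith)
      _ ≤ _ := by linarith

open Classical in
/-- The lopsided local lemma for CNF formulas. -/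
theorem satisfiable_of_lopsided {F : CNF} (hF : ∀ C ∈ F, Clause.Consistent C)
    (hp : ∀ l, 0 ≤ p l) (hp1 : ∀ v, p (v, true) + p (v, false) = 1) {x : ℝ} (hx0 : 0 ≤ x)
    (hx1 : x < 1) (h : ∀ C ∈ F, ∏ l ∈ C, (1 - p l) ≤
      x * (1 - x) ^ (F.filter fun D => Clause.Conflicts C D).card) : CNF.Satisfiable F := by
  obtain ⟨N, hN⟩ : ∃ N, ∀ C ∈ F, ∀ l ∈ C, l.1 < N := by
    refine ⟨(F.sup fun C => C.sup fun l => l.1) + 1, fun C hC l hl => Nat.lt_succ_of_le ?_⟩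
    exact (le_sup (f := fun l : Literal => l.1) hl).trans
      (le_sup (f := fun C : Clause => C.sup fun l => l.1) hC)
  have hprob0 : ∀ B, 0 ≤ prob N p B := fun B => sum_nonneg fun a _ => assignmentWeight_nonneg hp a
  have key : ∀ n, ∀ S ⊆ F, S.card < n → ∀ C ∈ F,
      prob N p (satAssignments S ∩ {a | Clause.SatisfiedBy C a}ᶜ) ≤
        x * prob N p (satAssignments S) := by
    intro n
    induction n with
    | zero => intro S _ h; omega
    | succ n ih =>
      intro S hS hn C hC
      -- Making a literal of `C` true cannot falsify a clause that does not conflict with `C`, so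
      -- the unconditional bound survives conditioning on `S₂`. Adding `S₁` to the condition costs
      -- at most `(1 - x) ^ S₁.card`, by induction.
      set S₁ := S.filter fun D => Clause.Conflicts C D with hS₁
      set S₂ := S.filter fun D => ¬ Clause.Conflicts C D with hS₂
      have hunion : S₂ ∪ S₁ = S := by rw [union_comm]; exact filter_union_filter_not_eq _ _
      have hdisj : Disjoint S₂ S₁ := (disjoint_filter_filter_not _ _ _).symm
      have h1 : prob N p (satAssignments S ∩ {a | Clause.SatisfiedBy C a}ᶜ) ≤
          prob N p (satAssignments S₂ ∩ {a | Clause.SatisfiedBy C a}ᶜ) :=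
        prob_mono hp (Set.inter_subset_inter_left _ fun a ha D hD => ha D (mem_filter.1 hD).1)
      have h2 := prob_all_false_inter_le (N := N) (B := satAssignments S₂) hp hp1 (hF C hC) (hN C hC)
        (by
          intro l hl a ha D hD
          obtain ⟨l', hl', h'⟩ := ha D hD
          refine ⟨l', hl', ?_⟩
          by_cases heq : l'.1 = l.1
          · rw [heq, Function.update_self]
            by_contra hne
            refine (mem_filter.1 hD).2 ⟨l, hl, ?_⟩
            have : (l.1, !l.2) = l' := by
              ext
              · exact heq.symm
              · simp only
                cases h5 : l.2 <;> cases h6 : l'.2 <;> simp_all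
            rwa [this]
          · rwa [Function.update_of_ne heq])
      have h3 := pow_mul_prob_le (N := N) (p := p) hx1.le ih S₂ S₁ ((filter_subset _ _).trans hS)
        ((filter_subset _ _).trans hS) hdisj (by
          rw [← card_union_of_disjoint hdisj, hunion]; omega)
      rw [hunion] at h3
      have h4 : (1 - x) ^ (F.filter fun D => Clause.Conflicts C D).card ≤ (1 - x) ^ S₁.card :=
        pow_le_pow_of_le_one (by linarith) (by linarith)
          (card_le_card (filter_subset_filter _ hS))
      calc _ ≤ (∏ l ∈ C, (1 - p l)) * prob N p (satAssignments S₂) := h1.trans h2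
        _ ≤ x * (1 - x) ^ S₁.card * prob N p (satAssignments S₂) :=
            mul_le_mul_of_nonneg_right
              ((h C hC).trans (mul_le_mul_of_nonneg_left h4 hx0)) (hprob0 _)
        _ = x * ((1 - x) ^ S₁.card * prob N p (satAssignments S₂)) := by ring
        _ ≤ _ := mul_le_mul_of_nonneg_left h3 hx0
  have h1 := pow_mul_prob_le (N := N) (p := p) hx1.le (key F.card) ∅ F (empty_subset _) subset_rfl
    (disjoint_empty_left _) (by simp)
  have h2 : satAssignments ∅ = Set.univ := by ext a; simp [satAssignments]
  rw [h2, prob_univ hp1, empty_union, mul_one] at h1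
  have h3 : 0 < prob N p (satAssignments F) := lt_of_lt_of_le (pow_pos (by linarith) _) h1
  by_contra hsat
  have h4 : satAssignments F = ∅ := by
    ext a
    simp only [Set.mem_empty_iff_false, iff_false]
    exact fun ha => hsat ⟨a, ha⟩
  rw [h4] at h3
  simp [prob] at h3

end LopsidedLocalLemma

/-! ### The lower bound on `f`. -/

open Classical in
/-- Formulas in which all variables have few occurrences are satisfiable. -/
theorem satisfiable_of_occurrences_le {k s : ℕ} (hk : 2 ≤ k) (hs : 1 ≤ s)
    (h : ((s : ℝ) + 1) * (Real.exp 1 * k) ≤ 2 ^ (k + 1)) {F : CNF} (hF : CNF.IsKSCNF k s F) :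
    CNF.Satisfiable F := by
  -- Clauses with complementary literals hold under every assignment and can be dropped.
  set F' := F.filter fun C => Clause.Consistent C with hF'
  suffices hsat : CNF.Satisfiable F' by
    obtain ⟨a, ha⟩ := hsat
    refine ⟨a, fun C hC => ?_⟩
    by_cases hC' : Clause.Consistent C
    · exact ha C (mem_filter.2 ⟨hC, hC'⟩)
    · simp only [Clause.Consistent] at hC'
      push Not at hC'
      obtain ⟨l, hl, l', hl', h1, h2⟩ := hC'
      by_cases h3 : a l.1 = l.2
      · exact ⟨l, hl, h3⟩
      · refine ⟨l', hl', ?_⟩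
        have h4 : l.2 ≠ l'.2 := fun h => h2 (Prod.ext h1 h)
        rw [← h1]
        cases h5 : l.2 <;> cases h6 : l'.2 <;> simp_all
  set cnt : Literal → ℕ := fun l => (F'.filter fun D => l ∈ D).card with hcnt
  have hcnt_le : ∀ v, cnt (v, true) + cnt (v, false) ≤ s := by
    intro v
    refine le_trans (le_of_eq ?_) (hF.2 v |>.trans' (card_le_card
      (s := (F'.filter fun D => (v, true) ∈ D) ∪ (F'.filter fun D => (v, false) ∈ D)) ?_))
    · rw [card_union_of_disjoint]
      rw [Finset.disjoint_left]
      intro D hD hD'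
      have h1 := mem_filter.1 hD
      have := (mem_filter.1 h1.1).2 _ h1.2 _ (mem_filter.1 hD').2 rfl
      simp at this
    · intro D hD
      rcases mem_union.1 hD with hD | hD <;>
      · have h1 := mem_filter.1 hD
        exact mem_filter.2 ⟨(mem_filter.1 h1.1).1, mem_image.2 ⟨_, h1.2, rfl⟩⟩
  have hk0 : (2 : ℝ) ≤ k := by exact_mod_cast hk
  have hs0 : (1 : ℝ) ≤ s := by exact_mod_cast hs
  -- A literal whose negation is frequent brings its clauses many conflicts, so it is made true more
  -- often. The bias is scaled so that `k` literals are all false with probability at most `e / 2 ^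
  -- k` times `exp (-2 / (s * k))` per conflicting occurrence, and `exp (-2 / (s * k)) ≤ 1 - e / 2 ^
  -- k`.
  set q : ℕ → ℝ := fun v => 1 / 2 + (2 * cnt (v, false) - s) / (2 * s * k) with hq
  set p : Literal → ℝ := fun l => if l.2 then q l.1 else 1 - q l.1 with hp
  have hq1 : ∀ v, |(2 * (cnt (v, false) : ℝ) - s) / (2 * s * k)| ≤ 1 / 2 := by
    intro v
    have h1 := hcnt_le v
    have h2 : (cnt (v, false) : ℝ) ≤ s := by exact_mod_cast (by omega : cnt (v, false) ≤ s)
    have h3 : (0 : ℝ) ≤ cnt (v, false) := Nat.cast_nonneg _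
    rw [abs_le]
    constructor
    · rw [le_div_iff₀ (by positivity)]; nlinarith
    · rw [div_le_iff₀ (by positivity)]; nlinarith
  have hp0 : ∀ l, 0 ≤ p l := by
    intro l
    have := abs_le.1 (hq1 l.1)
    simp only [hp, hq]
    split_ifs <;> linarith
  have hp1 : ∀ v, p (v, true) + p (v, false) = 1 := by intro v; simp [hp]
  have hple : ∀ l, 1 - p l ≤ 1 / 2 * Real.exp (1 / k - 2 / (s * k) * cnt (l.1, !l.2)) := by
    rintro ⟨v, b⟩
    have h1 : 1 - p (v, b) ≤ 1 / 2 * (1 / k - 2 / (s * k) * cnt (v, !b) + 1) := by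
      cases b
      · simp only [hp, hq, Bool.false_eq_true, if_false, Bool.not_false]
        have h2 : (cnt (v, true) : ℝ) + cnt (v, false) ≤ s := by exact_mod_cast hcnt_le v
        have h3 : (2 * (cnt (v, false) : ℝ) - s) / (2 * s * k) ≤
            (s - 2 * cnt (v, true)) / (2 * s * k) :=
          div_le_div_of_nonneg_right (by linarith) (by positivity)
        have h4 : ((s : ℝ) - 2 * cnt (v, true)) / (2 * s * k) =
          1 / 2 * (1 / k - 2 / (s * k) * cnt (v, true)) := by field_simp
        linarith
      · simp only [hp, hq, if_true, Bool.not_true]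
        refine le_of_eq ?_
        field_simp
        ring
    exact h1.trans (mul_le_mul_of_nonneg_left (Real.add_one_le_exp _) (by norm_num))
  set x : ℝ := Real.exp 1 / 2 ^ k with hx
  have hx0 : 0 ≤ x := by positivity
  set y : ℝ := 2 / (s * k) with hy
  have hy0 : 0 < y := by positivity
  have hxy : x * (1 + y) ≤ y := by
    have h1 : x * (1 + y) = Real.exp 1 * (s * k + 2) / (2 ^ k * (s * k)) := by
      rw [hx, hy]; field_simp
    rw [h1, hy, div_le_div_iff₀ (by positivity) (by positivity)]
    have h2 : Real.exp 1 * (s * k + 2) ≤ 2 ^ (k + 1) := by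
      refine le_trans ?_ h
      have := Real.exp_pos 1
      nlinarith
    rw [pow_succ] at h2
    have h3 : (0 : ℝ) < s * k := by positivity
    nlinarith
  have hx1 : x < 1 := by nlinarith
  have hexp : Real.exp (-y) ≤ 1 - x := by
    have h1 := Real.add_one_le_exp y
    rw [Real.exp_neg]
    calc (Real.exp y)⁻¹ ≤ (1 + y)⁻¹ := by gcongr; linarith
      _ ≤ 1 - x := by rw [inv_le_iff_one_le_mul₀ (by positivity)]; nlinarith
  refine satisfiable_of_lopsided (fun C hC => (mem_filter.1 hC).2) hp0 hp1 hx0 hx1 ?_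
  intro C hC
  have hCk : C.card = k := hF.1 C (mem_filter.1 hC).1
  have hdeg : (F'.filter fun D => Clause.Conflicts C D).card ≤ ∑ l ∈ C, cnt (l.1, !l.2) := by
    refine (card_le_card ?_).trans (card_biUnion_le (s := C)
      (t := fun l => F'.filter fun D => (l.1, !l.2) ∈ D))
    intro D hD
    obtain ⟨h1, l, h2, h3⟩ := mem_filter.1 hD
    exact mem_biUnion.2 ⟨l, h2, mem_filter.2 ⟨h1, h3⟩⟩
  have hp1' : ∀ l, 0 ≤ 1 - p l := by
    rintro ⟨v, b⟩
    have h1 := hp1 v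
    have h2 := hp0 (v, true)
    have h3 := hp0 (v, false)
    cases b <;> linarith
  calc ∏ l ∈ C, (1 - p l)
      ≤ ∏ l ∈ C, (1 / 2 * Real.exp (1 / k - y * cnt (l.1, !l.2))) :=
        prod_le_prod (fun l _ => hp1' l) fun l _ => hple l
    _ = x * Real.exp (-y) ^ (∑ l ∈ C, cnt (l.1, !l.2)) := by
        have hsum : ∑ l ∈ C, (1 / (k : ℝ) - y * cnt (l.1, !l.2)) =
            1 + ((∑ l ∈ C, cnt (l.1, !l.2) : ℕ) : ℝ) * (-y) := by
          rw [sum_sub_distrib, sum_const, hCk, ← mul_sum, nsmul_eq_mul,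
            mul_one_div_cancel (by positivity)]
          push_cast
          ring
        rw [prod_mul_distrib, prod_const, hCk, ← Real.exp_sum, hsum, Real.exp_add,
          ← Real.exp_nat_mul, hx, one_div, inv_pow]
        ring
    _ ≤ x * (1 - x) ^ (∑ l ∈ C, cnt (l.1, !l.2)) := by gcongr
    _ ≤ _ := mul_le_mul_of_nonneg_left
        (pow_le_pow_of_le_one (by linarith) (by linarith) hdeg) hx0

/-! ### Existence of the maxima and asymptotics. -/

theorem CNF.IsKSCNF.mono {k s t : ℕ} {F : CNF} (h : CNF.IsKSCNF k s F) (hst : s ≤ t) :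
    CNF.IsKSCNF k t F := ⟨h.1, fun v => (h.2 v).trans hst⟩

theorem satisfiable_of_isKSCNF_zero {k : ℕ} (hk : 1 ≤ k) {F : CNF} (h : CNF.IsKSCNF k 0 F) :
    CNF.Satisfiable F := by
  refine ⟨fun _ => true, fun C hC => ?_⟩
  obtain ⟨l, hl⟩ := card_pos.1 (by rw [h.1 C hC]; omega : 0 < C.card)
  have h1 := h.2 l.1
  rw [CNF.occurrences, Nat.le_zero, card_eq_zero, filter_eq_empty_iff] at h1
  exact absurd (mem_image_of_mem _ hl) (h1 hC)

theorem lt_of_mem_noMU1Set {k s t : ℕ} {F : CNF} (hF : CNF.IsKSCNF k s F) (hF' : CNF.IsMU1 F)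
    (ht : t ∈ noMU1Set k) : t < s := by
  by_contra h
  exact ht F (hF.mono (not_lt.1 h)) hF'

theorem satSet_subset_noMU1Set (k : ℕ) : satSet k ⊆ noMU1Set k :=
  fun _ hs F hF h => h.1.1 (hs F hF)

theorem bddAbove_noMU1Set {k : ℕ} (hk : 1 ≤ k) : BddAbove (noMU1Set k) := by
  obtain ⟨F, hF⟩ := exists_formula_of_good hk (good_zero_two_pow k)
  exact ⟨2 ^ k, fun t ht => (lt_of_mem_noMU1Set hF.1 hF.2 ht).le⟩

theorem isGreatest_f {k : ℕ} (hk : 1 ≤ k) : IsGreatest (satSet k) (f k) := by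
  have hb := (bddAbove_noMU1Set hk).mono (satSet_subset_noMU1Set k)
  exact ⟨Nat.sSup_mem ⟨0, fun F hF => satisfiable_of_isKSCNF_zero hk hF⟩ hb,
    fun s hs => le_csSup hb hs⟩

theorem isGreatest_f₁ {k : ℕ} (hk : 1 ≤ k) : IsGreatest (noMU1Set k) (f₁ k) := by
  have hb := bddAbove_noMU1Set hk
  exact ⟨Nat.sSup_mem ⟨0, fun F hF h => h.1.1 (satisfiable_of_isKSCNF_zero hk hF)⟩ hb,
    fun s hs => le_csSup hb hs⟩

theorem f_le_f₁ {k : ℕ} (hk : 1 ≤ k) : f k ≤ f₁ k :=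
  (isGreatest_f₁ hk).2 (satSet_subset_noMU1Set k (isGreatest_f hk).1)

theorem floor_sub_one_le_f {k : ℕ} (hk : 1 ≤ k) :
    ⌊(2 : ℝ) ^ (k + 1) / (Real.exp 1 * (k : ℝ))⌋ - 1 ≤ (f k : ℤ) := by
  set A : ℝ := (2 : ℝ) ^ (k + 1) / (Real.exp 1 * (k : ℝ)) with hA
  have hk0 : (0 : ℝ) < k := by exact_mod_cast hk
  have he := Real.exp_one_gt_d9
  by_cases hA1 : ⌊A⌋ - 1 ≤ 0
  · exact hA1.trans (Int.natCast_nonneg _)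
  push Not at hA1
  obtain ⟨s, hs⟩ := Int.eq_ofNat_of_zero_le hA1.le
  have hs1 : 1 ≤ s := by omega
  have hsA : (s : ℝ) + 1 ≤ A := by
    have h1 := Int.floor_le A
    rw [show ⌊A⌋ = (s : ℤ) + 1 by omega] at h1
    exact_mod_cast h1
  rw [hA, le_div_iff₀ (by positivity)] at hsA
  -- For `k = 1` the quotient `4 / e` is below 2, so the bound is trivial there.
  have hk2 : 2 ≤ k := by
    by_contra h
    have : k = 1 := by omega
    subst this
    have h2 : (1 : ℝ) ≤ s := by exact_mod_cast hs1
    norm_num at hsA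
    nlinarith
  rw [hs]
  exact_mod_cast (isGreatest_f hk).2 fun F hF => satisfiable_of_occurrences_le hk2 hs1 hsA hF

theorem sq_le_two_pow_succ (k : ℕ) : k ^ 2 ≤ 2 ^ (k + 1) := by
  by_cases h : 10 ≤ k
  · have := eight_mul_sq_le_two_pow h
    rw [pow_succ 2 k]
    omega
  · push Not at h
    interval_cases k <;> norm_num

/-- Lets additive constants, such as the loss from rounding, be absorbed into the error term. -/
theorem one_le_rpow_mul {k : ℕ} (hk : 1 ≤ k) :
    1 ≤ (k : ℝ) ^ (-(1 / 2 : ℝ)) * ((2 : ℝ) ^ (k + 1) / k) := by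
  have hk0 : (0 : ℝ) < k := by exact_mod_cast hk
  have hk1 : (1 : ℝ) ≤ k := by exact_mod_cast hk
  rw [mul_div_assoc', one_le_div hk0]
  have h1 : (k : ℝ)⁻¹ ≤ (k : ℝ) ^ (-(1 / 2 : ℝ)) := by
    rw [← Real.rpow_neg_one]
    exact Real.rpow_le_rpow_of_exponent_le hk1 (by norm_num)
  refine le_trans ?_ (mul_le_mul_of_nonneg_right h1 (by positivity))
  rw [inv_mul_eq_div, le_div_iff₀ hk0, ← sq]
  exact_mod_cast sq_le_two_pow_succ k

theorem isEquivalent_of_abs_sub_le {g : ℕ → ℝ} {C : ℝ}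
    (h : ∀ k : ℕ, 1 ≤ k → |g k - (Real.exp 1)⁻¹ * ((2 : ℝ) ^ (k + 1) / (k : ℝ))| ≤
      C * (k : ℝ) ^ (-(1 / 2 : ℝ)) * ((2 : ℝ) ^ (k + 1) / (k : ℝ))) :
    Asymptotics.IsEquivalent Filter.atTop g
      fun k : ℕ => (Real.exp 1)⁻¹ * ((2 : ℝ) ^ (k + 1) / (k : ℝ)) := by
  have hz : Filter.Tendsto (fun k : ℕ => C * (k : ℝ) ^ (-(1 / 2 : ℝ))) Filter.atTop (nhds 0) := by
    simpa using ((tendsto_rpow_neg_atTop (by norm_num : (0 : ℝ) < 1 / 2)).comp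
      tendsto_natCast_atTop_atTop).const_mul C
  rw [Asymptotics.IsEquivalent, Asymptotics.isLittleO_iff]
  intro c hc
  filter_upwards [hz.eventually_le_const (show 0 < c * (Real.exp 1)⁻¹ by positivity),
    Filter.eventually_ge_atTop 1] with k hk hk1
  have hB : (0 : ℝ) ≤ (2 : ℝ) ^ (k + 1) / k := by positivity
  rw [Pi.sub_apply, Real.norm_eq_abs, Real.norm_eq_abs]
  refine (h k hk1).trans ?_
  rw [abs_of_nonneg (by positivity), ← mul_assoc]
  exact mul_le_mul_of_nonneg_right hk hB

end KSat

theorem theorem1 :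
    -- the two maxima exist, so that `f` and `f₁` are well defined
    (∀ k : ℕ, 1 ≤ k →
      IsGreatest (KSat.satSet k) (KSat.f k) ∧ IsGreatest (KSat.noMU1Set k) (KSat.f₁ k)) ∧
    -- the lower bound
    (∀ k : ℕ, 1 ≤ k →
      ⌊(2 : ℝ) ^ (k + 1) / (Real.exp 1 * (k : ℝ))⌋ - 1 ≤ (KSat.f k : ℤ)) ∧
    -- the asymptotics, with the upper bound witnessed by formulas in MU(1)
    (∃ C : ℝ, ∀ k : ℕ, 1 ≤ k →
      |(KSat.f k : ℝ) - (Real.exp 1)⁻¹ * ((2 : ℝ) ^ (k + 1) / (k : ℝ))| ≤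
          C * (k : ℝ) ^ (-(1 / 2 : ℝ)) * ((2 : ℝ) ^ (k + 1) / (k : ℝ)) ∧
      ∃ (s : ℕ) (F : KSat.CNF), KSat.CNF.IsKSCNF k s F ∧ KSat.CNF.IsMU1 F ∧
        (s : ℝ) ≤ ((Real.exp 1)⁻¹ + C * (k : ℝ) ^ (-(1 / 2 : ℝ))) *
          ((2 : ℝ) ^ (k + 1) / (k : ℝ))) ∧
    -- `f(k) = (1 + o(1)) f₁(k)`
    Asymptotics.IsEquivalent Filter.atTop
      (fun k : ℕ => (KSat.f k : ℝ)) (fun k : ℕ => (KSat.f₁ k : ℝ)) := by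
  obtain ⟨C, hC0, hC⟩ := KSat.exists_mu1_formula
  have hlow : ∀ k : ℕ, 1 ≤ k →
      (Real.exp 1)⁻¹ * ((2 : ℝ) ^ (k + 1) / (k : ℝ)) - 2 ≤ KSat.f k := by
    intro k hk
    have h1 : ((⌊(2 : ℝ) ^ (k + 1) / (Real.exp 1 * (k : ℝ))⌋ - 1 : ℤ) : ℝ) ≤ KSat.f k := by
      exact_mod_cast KSat.floor_sub_one_le_f hk
    have h2 := Int.lt_floor_add_one ((2 : ℝ) ^ (k + 1) / (Real.exp 1 * (k : ℝ)))
    have h3 : (2 : ℝ) ^ (k + 1) / (Real.exp 1 * (k : ℝ)) =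
        (Real.exp 1)⁻¹ * ((2 : ℝ) ^ (k + 1) / (k : ℝ)) := by
      rw [inv_mul_eq_div, div_div, mul_comm (k : ℝ)]
    push_cast at h1
    linarith
  -- Both `f` and `f₁` lie between the local lemma bound and the parameter `s` of one MU(1) formula,
  -- so both are equivalent to the same function.
  have habs : ∀ g : ℕ → ℕ, (∀ k, 1 ≤ k → KSat.f k ≤ g k ∧ g k ≤ KSat.f₁ k) → ∀ k : ℕ, 1 ≤ k →
      |(g k : ℝ) - (Real.exp 1)⁻¹ * ((2 : ℝ) ^ (k + 1) / (k : ℝ))| ≤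
        (C + 2) * (k : ℝ) ^ (-(1 / 2 : ℝ)) * ((2 : ℝ) ^ (k + 1) / (k : ℝ)) := by
    intro g hg k hk
    obtain ⟨s, F, hF, hF', hs⟩ := hC k hk
    have h1 := KSat.one_le_rpow_mul hk
    have h2 := hlow k hk
    have h3 : (KSat.f k : ℝ) ≤ g k := by exact_mod_cast (hg k hk).1
    have h4 : (g k : ℝ) ≤ s := by
      exact_mod_cast (hg k hk).2.trans
        (KSat.lt_of_mem_noMU1Set hF hF' (KSat.isGreatest_f₁ hk).1).le
    rw [abs_le]
    set z := (k : ℝ) ^ (-(1 / 2 : ℝ))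
    set B := (2 : ℝ) ^ (k + 1) / (k : ℝ)
    have h5 : 0 ≤ C * (z * B) := mul_nonneg hC0 (by linarith)
    constructor <;> linarith
  have hf := habs KSat.f fun k hk => ⟨le_rfl, KSat.f_le_f₁ hk⟩
  have hf₁ := habs KSat.f₁ fun k hk => ⟨KSat.f_le_f₁ hk, le_rfl⟩
  refine ⟨fun k hk => ⟨KSat.isGreatest_f hk, KSat.isGreatest_f₁ hk⟩,
    fun k hk => KSat.floor_sub_one_le_f hk, ⟨C + 2, fun k hk => ⟨hf k hk, ?_⟩⟩,
    (KSat.isEquivalent_of_abs_sub_le hf).trans (KSat.isEquivalent_of_abs_sub_le hf₁).symm⟩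
  obtain ⟨s, F, hF, hF', hs⟩ := hC k hk
  refine ⟨s, F, hF, hF', hs.trans ?_⟩
  gcongr
  linarith
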